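/- **Setting.** Let $V=\{1,\dots,N\}$, $N\ge 1$, with symmetric conductances $\omega_{\{x,y\}}\ge 0$, $\omega_{\{x,x\}}=0$, such that the graph on $V$ with edges $\{x,y\}$, $\omega_{\{x,y\}}\neq 0$, is connected; let $\alpha_x\in\{1,2,\dots\}$ for $x\in V$, $\alpha_L,\alpha_R>0$, and $\omega_L,\omega_R\ge 0$ not both zero. Let $\sigma\in\{-1,0,1\}$ (exclusion, independent walkers, inclusion) and let $\theta_L,\theta_R\in[0,\infty)$, with $\theta_L,\theta_R\in[0,1]$ if $\sigma=-1$. Put $\mathcal X=\prod_{x\in V}\{0,\dots,\alpha_x\}$ if $\sigma=-1$ and $\mathcal X=\mathbb N_0^V$ otherwise, and $\eta^{x,y}=\eta-\delta_x+\delta_y$. The *boundary driven system* is the continuous-time Markov chain on $\mathcal X$ with generator $$\mathcal Lf(\eta)=\sum_{x,y\in V}\omega_{\{x,y\}}\,\eta(x)(\alpha_y+\sigma\eta(y))\,(f(\eta^{x,y})-f(\eta))+\omega_L\mathcal L_Lf(\eta)+\omega_R\mathcal L_Rf(\eta),$$ $$\mathcal L_Lf(\eta)=\eta(1)(\alpha_L+\sigma\alpha_L\theta_L)(f(\eta-\delta_1)-f(\eta))+\alpha_L\theta_L(\alpha_1+\sigma\eta(1))(f(\eta+\delta_1)-f(\eta)),$$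 and $\mathcal L_R$ defined in the same way with $(1,L)$ replaced by $(N,R)$ (the first sum runs over ordered pairs). Let $\mu_{\theta_L,\theta_R}$ be a stationary probability measure of it, and let $\bar\theta_x=\mathbb E_{\mu_{\theta_L,\theta_R}}[\eta(x)/\alpha_x]$. The *dual system* is the continuous-time Markov chain $(\xi_t)$ on $\widehat{\mathcal X}=\mathcal X\times\mathbb N_0^{\{L,R\}}$ with generator $$\widehat{\mathcal L}f(\xi)=\sum_{x,y\in V}\omega_{\{x,y\}}\,\xi(x)(\alpha_y+\sigma\xi(y))(f(\xi^{x,y})-f(\xi))+\omega_L\alpha_L\,\xi(1)(f(\xi^{1,L})-f(\xi))+\omega_R\alpha_R\,\xi(N)(f(\xi^{N,R})-f(\xi)).$$ Let $|\xi|$ be the total number of particles of $\xi$, and let $\widehat{\mathbb P}_\xi(\xi_\infty(L)=|\xi|)=\lim_{t\to\infty}\widehat{\mathbb P}_\xi(\xi_t=|\xi|\,\delta_L)$ be the probability that all the particles are eventually absorbed in $L$. Write $\widehat{\mathbb P}^{\mathrm{IRW}}$ for the law of the dual system with $\sigma=0$ (and the same conductances and site parameters). For $A\subseteq V$ put $\delta_A=\sum_{x\in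 A}\delta_x$ and $$\psi(\delta_A)=\sum_{B\subseteq A}(-1)^{|A|-|B|}\;\widehat{\mathbb P}^{\mathrm{IRW}}_{\delta_{A\setminus B}}\big(\xi_\infty(L)=|A\setminus B|\big)\;\widehat{\mathbb P}_{\delta_B}\big(\xi_\infty(L)=|B|\big),$$ $$\varphi(\delta_A)=\sum_{\gamma}(|\gamma|-1)!\,(-1)^{|\gamma|-1}\prod_{U\in\gamma}\psi(\delta_U),$$ where $\gamma$ runs over the set partitions of $A$. These numbers depend only on $\sigma$, $(\omega_{\{x,y\}})$, $(\alpha_x)$, $\omega_L,\omega_R,\alpha_L,\alpha_R$, and not on $\theta_L,\theta_R$. **Corollary (joint cumulants).** The limits that define the absorption probabilities exist, the variables $\eta(x)/\alpha_x$ and all products $\prod_{x\in U}(\eta(x)/\alpha_x-\bar\theta_x)$, $U\subseteq V$, are $\mu_{\theta_L,\theta_R}$-integrable, and for all $n\ge 1$ and all pairwise distinct $x_1,\dots,x_n\in V$ the joint cumulant $$\kappa(\delta_{x_1}+\dots+\delta_{x_n})=\sum_{\gamma}(|\gamma|-1)!\,(-1)^{|\gamma|-1}\prod_{U\in\gamma}\mathbb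 E_{\mu_{\theta_L,\theta_R}}\Big[\prod_{y\in U}\Big(\frac{\eta(y)}{\alpha_y}-\bar\theta_y\Big)\Big]$$ of the variables $\eta(x_i)/\alpha_{x_i}-\bar\theta_{x_i}$, $i=1,\dots,n$, where $\gamma$ runs over the set partitions of $\{x_1,\dots,x_n\}$, satisfies $$\kappa(\delta_{x_1}+\dots+\delta_{x_n})=(\theta_L-\theta_R)^n\,\varphi(\delta_{x_1}+\dots+\delta_{x_n}).$$ -/

import Mathlib

open MeasureTheory Filter Topology
open scoped ENNReal

noncomputable section

namespace BoundaryDriven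

/-! ### Continuous-time Markov chains on a countable set -/

section MarkovChain

variable {S : Type*}

/-- Total rate `∑_{y ≠ x} q(x,y)` at which a chain with jump rates `q` leaves `x`. -/
def exitRate (q : S → S → ℝ) (x : S) : ℝ :=
  ∑' y : {y : S // y ≠ x}, q x y

open Classical in
/-- Probability that the jump process with jump rates `q`, started from `x`, makes fewer than `n`
jumps before time `t` and is at `y` at time `t` (decomposition at the first jump). -/
def transitionUpTo (q : S → S → ℝ) : ℕ → ℝ → S → S → ℝ≥0∞
  | 0, _, _, _ => 0
  | n + 1, t, x, y =>
      (if x = y then ENNReal.ofReal (Real.exp (-(exitRate q x * t))) else 0) +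
        ∫⁻ s in Set.Icc (0 : ℝ) t, ENNReal.ofReal (Real.exp (-(exitRate q x * s))) *
          ∑' z : {z : S // z ≠ x}, ENNReal.ofReal (q x z) * transitionUpTo q n (t - s) z y

/-- Transition function `p_t(x,y)`, `t ≥ 0`, of the (minimal) continuous-time Markov chain with
jump rates `q`, by Feller's construction. -/
def transition (q : S → S → ℝ) (t : ℝ) (x y : S) : ℝ≥0∞ :=
  ⨆ n : ℕ, transitionUpTo q n t x y

/-- `μ` is a stationary measure of the Markov chain with jump rates `q`: `μ p_t = μ` for all
`t ≥ 0`. -/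
def IsStationary [MeasurableSpace S] (q : S → S → ℝ) (μ : Measure S) : Prop :=
  ∀ t : ℝ, 0 ≤ t → ∀ y : S, ∑' x : S, μ {x} * transition q t x y = μ {y}

end MarkovChain

/-! ### The underlying geometry -/

/-- Sites `V = Fin N`, with conductances, site parameters and boundary parameters. The sites
`1` and `N` of `{1, …, N}` are the first and the last element of `Fin N`. -/
structure Geometry (N : ℕ) where
  /-- conductances `ω_{x,y}` -/
  ω : Fin N → Fin N → ℝ
  ω_nonneg : ∀ x y, 0 ≤ ω x y
  ω_symm : ∀ x y, ω x y = ω y x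
  ω_self : ∀ x, ω x x = 0
  connected : (SimpleGraph.fromRel fun x y => ω x y ≠ 0).Connected
  /-- site parameters `α_x` -/
  α : Fin N → ℕ
  α_pos : ∀ x, 0 < α x
  ωL : ℝ
  ωR : ℝ
  αL : ℝ
  αR : ℝ
  ωL_nonneg : 0 ≤ ωL
  ωR_nonneg : 0 ≤ ωR
  ω_boundary : 0 < ωL ∨ 0 < ωR
  αL_pos : 0 < αL
  αR_pos : 0 < αR

/-- The site `1`. -/
def firstSite (N : ℕ) [NeZero N] : Fin N := ⟨0, NeZero.pos N⟩

/-- The site `N`. -/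
def lastSite (N : ℕ) [NeZero N] : Fin N := ⟨N - 1, Nat.sub_lt (NeZero.pos N) Nat.one_pos⟩

variable {N : ℕ}

/-- The configuration space `𝒳`. The interaction parameter `σ ∈ {-1, 0, 1}` is an element of
`SignType`: exclusion, independent walkers, inclusion. -/
abbrev Config (σ : SignType) (G : Geometry N) : Type :=
  {η : Fin N → ℕ // σ = -1 → ∀ x, η x ≤ G.α x}

/-- `η^{x,-}`. It is only used with a rate that vanishes if `η x = 0`. -/
def removeAt (η : Fin N → ℕ) (x : Fin N) : Fin N → ℕ := η - Pi.single x 1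

/-- `η^{x,+}`. -/
def addAt (η : Fin N → ℕ) (x : Fin N) : Fin N → ℕ := η + Pi.single x 1

/-- `η^{x,y} = η - δ_x + δ_y`. It is only used with a rate that vanishes if `η x = 0`. -/
def moveTo (η : Fin N → ℕ) (x y : Fin N) : Fin N → ℕ := addAt (removeAt η x) y

/-! ### The boundary driven particle system -/

/-- The bulk generator. The sum over unordered pairs of the two directed contributions is written
as a sum over ordered pairs. -/
def bulkGenerator (σ : SignType) (G : Geometry N) (f : (Fin N → ℕ) → ℝ) (η : Fin N → ℕ) : ℝ :=
  ∑ x, ∑ y, G.ω x y *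
    ((η x : ℝ) * ((G.α y : ℝ) + (σ : ℝ) * (η y : ℝ)) * (f (moveTo η x y) - f η))

/-- The generator of a reservoir with parameters `a`, `θ`, attached to the site `x`. -/
def reservoirGenerator (σ : SignType) (G : Geometry N) (a θ : ℝ) (x : Fin N)
    (f : (Fin N → ℕ) → ℝ) (η : Fin N → ℕ) : ℝ :=
  (η x : ℝ) * (a + (σ : ℝ) * a * θ) * (f (removeAt η x) - f η) +
    a * θ * ((G.α x : ℝ) + (σ : ℝ) * (η x : ℝ)) * (f (addAt η x) - f η)

/-- The generator `ℒ` of the boundary driven particle system. -/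
def generator [NeZero N] (σ : SignType) (G : Geometry N) (θL θR : ℝ)
    (f : (Fin N → ℕ) → ℝ) (η : Fin N → ℕ) : ℝ :=
  bulkGenerator σ G f η +
    (G.ωL * reservoirGenerator σ G G.αL θL (firstSite N) f η +
      G.ωR * reservoirGenerator σ G G.αR θR (lastSite N) f η)

/-- The jump rates on `𝒳`: for `η ≠ η'`, the rate from `η` to `η'` is `(ℒ 1_{η'})(η)`. -/
def rate [NeZero N] (σ : SignType) (G : Geometry N) (θL θR : ℝ) (η η' : Config σ G) : ℝ :=
  generator σ G θL θR (Set.indicator {η'.1} 1) η.1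

/-! ### The dual particle system -/

/-- The dual configuration space `𝒳 × ℕ^{L,R}`; the last two entries are `ξ(L)` and `ξ(R)`. -/
abbrev DualConfig (σ : SignType) (G : Geometry N) : Type := Config σ G × ℕ × ℕ

/-- The generator of the dual system, absorbed at `L` and `R`. -/
def dualGenerator [NeZero N] (σ : SignType) (G : Geometry N)
    (f : (Fin N → ℕ) × ℕ × ℕ → ℝ) (ξ : (Fin N → ℕ) × ℕ × ℕ) : ℝ :=
  bulkGenerator σ G (fun η => f (η, ξ.2)) ξ.1 +
    (G.ωL * G.αL * (ξ.1 (firstSite N) : ℝ) *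
        (f (removeAt ξ.1 (firstSite N), ξ.2.1 + 1, ξ.2.2) - f ξ) +
      G.ωR * G.αR * (ξ.1 (lastSite N) : ℝ) *
        (f (removeAt ξ.1 (lastSite N), ξ.2.1, ξ.2.2 + 1) - f ξ))

/-- The jump rates of the dual system. -/
def dualRate [NeZero N] (σ : SignType) (G : Geometry N) (ξ ξ' : DualConfig σ G) : ℝ :=
  dualGenerator σ G (Set.indicator {(ξ'.1.1, ξ'.2)} 1) (ξ.1.1, ξ.2)

/-- `|ξ|`. -/
def size {σ : SignType} {G : Geometry N} (ξ : DualConfig σ G) : ℕ :=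
  ξ.2.1 + ξ.2.2 + ∑ x, ξ.1.1 x

/-- The dual configuration with `k` particles, all of them in `L`. -/
def allLeft (σ : SignType) (G : Geometry N) (k : ℕ) : DualConfig σ G :=
  (⟨0, fun _ _ => Nat.zero_le _⟩, k, 0)

/-- `p̂_∞(ξ, |ξ|δ_L) = lim_{t → ∞} p̂_t(ξ, |ξ|δ_L)`, the probability `P̂_ξ(ξ_∞(L) = |ξ|)` that all the
dual particles are absorbed in `L`. -/
def absorbedLeft [NeZero N] (σ : SignType) (G : Geometry N) (ξ : DualConfig σ G) : ℝ≥0∞ :=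
  limUnder atTop fun t : ℝ => transition (dualRate σ G) t ξ (allLeft σ G (size ξ))

/-- The dual configuration `∑_{x ∈ A} δ_x`. -/
def deltaSum (σ : SignType) (G : Geometry N) (A : Finset (Fin N)) : DualConfig σ G :=
  (⟨fun x => if x ∈ A then 1 else 0, fun _ x => by
    have h := G.α_pos x
    dsimp only
    split_ifs <;> omega⟩, 0, 0)

/-- `ψ(∑_{x ∈ A} δ_x)`: the subconfigurations of `∑_{x ∈ A} δ_x` are the `∑_{x ∈ B} δ_x` with
`B ⊆ A`, and the complementary particles `A \ B` move as independent walkers (`σ = 0`). -/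
def correlationCoeff [NeZero N] (σ : SignType) (G : Geometry N) (A : Finset (Fin N)) : ℝ :=
  ∑ B ∈ A.powerset, (-1) ^ (A.card - B.card) *
    (absorbedLeft 0 G (deltaSum 0 G (A \ B))).toReal *
    (absorbedLeft σ G (deltaSum σ G B)).toReal

/-- `φ(∑_{x ∈ A} δ_x)`. -/
def cumulantCoeff [NeZero N] (σ : SignType) (G : Geometry N) (A : Finset (Fin N)) : ℝ :=
  ∑ γ : Finpartition A, ((γ.parts.card - 1).factorial : ℝ) * (-1) ^ (γ.parts.card - 1) *
    ∏ U ∈ γ.parts, correlationCoeff σ G U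

/-! ### Cumulants and the stationary profile -/

/-- The joint cumulant of the random variables `X i`, `i ∈ A`, for a nonempty `A`. -/
def jointCumulant {Ω ι : Type*} [MeasurableSpace Ω] [DecidableEq ι] (μ : Measure Ω)
    (A : Finset ι) (X : ι → Ω → ℝ) : ℝ :=
  ∑ γ : Finpartition A, ((γ.parts.card - 1).factorial : ℝ) * (-1) ^ (γ.parts.card - 1) *
    ∏ U ∈ γ.parts, ∫ ω, ∏ i ∈ U, X i ω ∂μ

/-- `η(x)/α_x` -/
def scaledOccupation {σ : SignType} {G : Geometry N} (x : Fin N) (η : Config σ G) : ℝ :=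
  (η.1 x : ℝ) / (G.α x : ℝ)

/-- `η(x)/α_x - θ̄_x`, where `θ̄_x` is the expectation of `η(x)/α_x` under `μ`. -/
def centredOccupation {σ : SignType} {G : Geometry N} (μ : Measure (Config σ G)) (x : Fin N)
    (η : Config σ G) : ℝ :=
  scaledOccupation x η - ∫ η', scaledOccupation x η' ∂μ

end BoundaryDriven

end

open BoundaryDriven

/-! The argument is duality. For a parameter `θ` the function `dualFun` is `(θL - θ) ^ ξ(L) * (θR -
θ) ^ ξ(R)` times a product over the sites of polynomials of degree `ξ x` in `η x`, and the generator
of the driven system acting on `η` equals the dual generator acting on `ξ` (`generator_dualFun`).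
Under a stationary measure its expectation is therefore harmonic in `ξ`. The choice `θ = θR` makes
the boundary values vanish as soon as one particle sits in `R`, so for `n` particles the expectation
is `(θL - θR) ^ n` times the probability that all are absorbed in `L` (`integral_dualFun`, by
uniqueness of harmonic functions on a finite absorbing chain, `eq_of_harmonic`).

For `ξ = δ_A` the duality function is the product over `A` of `η x / α x - θR`. One particle does
not feel the interaction (`absorption_single`), so the mean profile is `θR + (θL - θR) p_x`, with
`p_x` the one-particle absorption probability for every `σ`. Recentring from `θR` to the mean
produces products of the `p_x`, which are absorption probabilities of independent walkers
(`absorption_independent`); this gives the centred moments as `(θL - θR) ^ |A|` times `ψ`. Cumulants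
inherit the factor because the blocks of a partition of `A` have total size `|A|`.

The analytic work is that `μ` is an arbitrary stationary measure of Feller's minimal chain, possibly
with unbounded rates. Moments are bounded by a Lyapunov function built from the nonnegative duality
functions at `θ = 0`, weighted by occupation times of the killed dual chain (`exists_occupation`,
`integrable_dualFun_zero`). Stationarity of the semigroup is turned into `∫ ℒ f dμ = 0` by comparing
the flows into and out of each state (`JumpRep.flow_le`, `JumpRep.integral_generator_eq_zero`). -/

noncomputable section

namespace BoundaryDriven

/-! ### Chains with finitely many jumps from every state -/

section FiniteJumps

variable {S ι : Type*} [Fintype ι] {q : S → S → ℝ} {c : ι → S → ℝ} {T : ι → S → S}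

open Classical in
/-- The jump rates `q` are those of the chain which jumps from `x` to `T i x` at rate `c i x`. -/
structure JumpRep (q : S → S → ℝ) (c : ι → S → ℝ) (T : ι → S → S) : Prop where
  nonneg : ∀ i x, 0 ≤ c i x
  ne : ∀ i x, c i x ≠ 0 → T i x ≠ x
  rate : ∀ x y, x ≠ y → q x y = ∑ i, if T i x = y then c i x else 0

/-- The total jump rate. -/
def totalRate (c : ι → S → ℝ) (x : S) : ℝ := ∑ i, c i x

/-- The mean of `f` after the jumps, weighted by the rates. -/
def jumpSum (c : ι → S → ℝ) (T : ι → S → S) (f : S → ℝ≥0∞) (x : S) : ℝ≥0∞ :=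
  ∑ i, ENNReal.ofReal (c i x) * f (T i x)

lemma jumpSum_mono {f g : S → ℝ≥0∞} (h : f ≤ g) (x : S) : jumpSum c T f x ≤ jumpSum c T g x :=
  Finset.sum_le_sum fun _ _ => mul_le_mul_right (h _) _

lemma JumpRep.totalRate_nonneg (h : JumpRep q c T) (x : S) : 0 ≤ totalRate c x :=
  Finset.sum_nonneg fun i _ => h.nonneg i x

lemma JumpRep.exitRate_eq (h : JumpRep q c T) (x : S) : exitRate q x = totalRate c x := by
  classical
  have key : HasSum (fun y : {y : S // y ≠ x} => ∑ i, if T i x = y then c i x else 0)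
      (∑ i, c i x) := by
    refine hasSum_sum fun i _ => ?_
    by_cases hc : c i x = 0
    · simp [hc, hasSum_zero]
    · have := hasSum_ite_eq (⟨T i x, h.ne i x hc⟩ : {y : S // y ≠ x}) (c i x)
      refine this.congr_fun ?_ |> id
      intro y
      simp only [Subtype.ext_iff, eq_comm]
  unfold exitRate totalRate
  rw [← key.tsum_eq]
  exact tsum_congr fun y => h.rate x y (Ne.symm y.2)

/-- Makes Feller's recursion a finite sum over jump labels. Labels of rate zero drop out, so `T` may
take any value there. -/
lemma JumpRep.tsum_eq (h : JumpRep q c T) (x : S) (g : S → ℝ≥0∞) :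
    ∑' z : {z : S // z ≠ x}, ENNReal.ofReal (q x z) * g z = jumpSum c T g x := by
  classical
  have e : ∀ z : {z : S // z ≠ x}, ENNReal.ofReal (q x z) * g z =
      ∑ i, (if T i x = z then ENNReal.ofReal (c i x) * g z else 0) := by
    intro z
    rw [h.rate x z (Ne.symm z.2), ENNReal.ofReal_sum_of_nonneg, Finset.sum_mul]
    · refine Finset.sum_congr rfl fun i _ => ?_
      split_ifs <;> simp
    · intro i _
      split_ifs
      · exact h.nonneg i x
      · exact le_rfl
  rw [tsum_congr e, Summable.tsum_finsetSum fun _ _ => ENNReal.summable, jumpSum]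
  refine Finset.sum_congr rfl fun i _ => ?_
  by_cases hc : c i x = 0
  · simp [hc]
  · rw [tsum_eq_single (⟨T i x, h.ne i x hc⟩ : {y : S // y ≠ x})]
    · simp
    · intro z hz
      rw [if_neg]
      rintro e
      exact hz (Subtype.ext e.symm)

open Classical in
lemma JumpRep.transitionUpTo_succ (h : JumpRep q c T) (n : ℕ) (t : ℝ) (x y : S) :
    transitionUpTo q (n + 1) t x y =
      (if x = y then ENNReal.ofReal (Real.exp (-(totalRate c x * t))) else 0) +
        ∫⁻ s in Set.Icc (0 : ℝ) t, ENNReal.ofReal (Real.exp (-(totalRate c x * s))) *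
          jumpSum c T (fun z => transitionUpTo q n (t - s) z y) x := by
  rw [transitionUpTo, h.exitRate_eq]
  congr 1
  refine lintegral_congr fun s => ?_
  rw [h.tsum_eq x (fun z => transitionUpTo q n (t - s) z y)]

lemma transitionUpTo_mono_nat (q : S → S → ℝ) (t : ℝ) (x y : S) :
    Monotone fun n => transitionUpTo q n t x y := by
  refine monotone_nat_of_le_succ fun n => ?_
  induction n generalizing t x with
  | zero => simp [transitionUpTo]
  | succ n ih =>
    rw [transitionUpTo, transitionUpTo]
    gcongr with s z
    exact ih _ _

/-- Probabilities to be in an absorbing state increase with time. -/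
lemma transitionUpTo_mono_time {a : S} (ha : exitRate q a = 0) (n : ℕ) (x : S) :
    Monotone fun t => transitionUpTo q n t x a := by
  induction n generalizing x with
  | zero => intro t t' _; simp [transitionUpTo]
  | succ n ih =>
    intro t t' htt
    simp only [transitionUpTo]
    refine add_le_add ?_ ?_
    · split_ifs with hx
      · subst hx; simp [ha]
      · exact le_rfl
    · refine (lintegral_mono fun s => ?_).trans
        (lintegral_mono_set (Set.Icc_subset_Icc_right htt))
      gcongr with z
      exact ih z (by linarith)

lemma transition_mono_time {a : S} (ha : exitRate q a = 0) (x : S) :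
    Monotone fun t => transition q t x a := fun _ _ h =>
  iSup_mono fun n => transitionUpTo_mono_time ha n x h

lemma lintegral_Icc_ofReal_deriv {F F' : ℝ → ℝ} {t : ℝ} (ht : 0 ≤ t)
    (hF : ∀ s, HasDerivAt F (F' s) s) (hc : Continuous F') (h0 : ∀ s ∈ Set.Icc 0 t, 0 ≤ F' s) :
    ∫⁻ s in Set.Icc 0 t, ENNReal.ofReal (F' s) = ENNReal.ofReal (F t - F 0) := by
  rw [← ofReal_integral_eq_lintegral_ofReal, integral_Icc_eq_integral_Ioc,
    ← intervalIntegral.integral_of_le ht,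
    intervalIntegral.integral_eq_sub_of_hasDerivAt (fun s _ => hF s) (hc.intervalIntegrable _ _)]
  · exact hc.continuousOn.integrableOn_Icc
  · exact (ae_restrict_iff' measurableSet_Icc).2 (Eventually.of_forall h0)

lemma hasDerivAt_neg_mul (l s : ℝ) : HasDerivAt (fun s => -(l * s)) (-l) s := by
  simpa using (hasDerivAt_id s).const_mul (-l)

lemma lintegral_exp_Icc {l t : ℝ} (hl : 0 < l) (ht : 0 ≤ t) :
    ∫⁻ s in Set.Icc 0 t, ENNReal.ofReal (Real.exp (-(l * s))) =
      ENNReal.ofReal ((1 - Real.exp (-(l * t))) / l) := by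
  rw [lintegral_Icc_ofReal_deriv (F := fun s => -Real.exp (-(l * s)) / l) ht]
  · congr 1; simp; ring
  · intro s
    exact ((hasDerivAt_neg_mul l s).exp.neg.div_const l).congr_deriv (by field_simp)
  · fun_prop
  · intro s _; positivity

lemma jumpSum_iSup {f : ℕ → S → ℝ≥0∞} (hf : ∀ z, Monotone fun n => f n z) (x : S) :
    jumpSum c T (fun z => ⨆ n, f n z) x = ⨆ n, jumpSum c T (f n) x := by
  simp only [jumpSum, ENNReal.mul_iSup]
  rw [ENNReal.finsetSum_iSup_of_monotone]
  intro i m n hmn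
  dsimp only
  gcongr
  exact hf _ hmn

/-- The probability that the chain is ever in the absorbing state `a`. -/
def hitting (q : S → S → ℝ) (a x : S) : ℝ≥0∞ := ⨆ m : ℕ, transitionUpTo q m m x a

/-- The diagonal in `hitting` loses nothing: the probability increases with the number of jumps
allowed and, `a` being absorbing, with time. -/
lemma transitionUpTo_le_hitting {a : S} (ha : exitRate q a = 0) (n : ℕ) (t : ℝ) (x : S) :
    transitionUpTo q n t x a ≤ hitting q a x := by
  refine le_trans ?_ (le_iSup _ (max n ⌈t⌉₊))
  refine (transitionUpTo_mono_nat q t x a (le_max_left n ⌈t⌉₊)).trans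
    (transitionUpTo_mono_time ha _ x ?_)
  exact (Nat.le_ceil t).trans (by exact_mod_cast le_max_right _ _)

/-- Monotonicity in time alone gives the limit, as a supremum. -/
lemma tendsto_transition_hitting {a : S} (ha : exitRate q a = 0) (x : S) :
    Tendsto (fun t => transition q t x a) atTop (𝓝 (hitting q a x)) := by
  have : hitting q a x = ⨆ t, transition q t x a := by
    refine le_antisymm (iSup_le fun m => ?_)
      (iSup_le fun t => iSup_le fun n => transitionUpTo_le_hitting ha n t x)
    exact (le_iSup (fun n => transitionUpTo q n (m : ℝ) x a) m).trans
      (le_iSup (fun t => transition q t x a) (m : ℝ))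
  rw [this]
  exact tendsto_atTop_iSup (transition_mono_time ha x)

lemma JumpRep.hitting_self (h : JumpRep q c T) {a : S} (ha : totalRate c a = 0) :
    1 ≤ hitting q a a := by
  classical
  refine le_trans ?_ (le_iSup _ 1)
  rw [h.transitionUpTo_succ]
  simp [ha]

lemma JumpRep.rate_eq_zero (h : JumpRep q c T) {b : S} (hb : totalRate c b = 0) (i : ι) :
    c i b = 0 :=
  (Finset.sum_eq_zero_iff_of_nonneg fun i _ => h.nonneg i b).1 hb i (Finset.mem_univ i)

lemma JumpRep.hitting_of_absorbing (h : JumpRep q c T) {a b : S} (hb : totalRate c b = 0)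
    (hab : b ≠ a) : hitting q a b = 0 := by
  classical
  simp only [hitting, ENNReal.iSup_eq_zero]
  rintro (_ | m)
  · simp [transitionUpTo]
  · rw [h.transitionUpTo_succ]
    simp [hab, jumpSum, h.rate_eq_zero hb]

/-- The hitting probability of an absorbing state is harmonic. -/
lemma JumpRep.hitting_harmonic (h : JumpRep q c T) {a : S} (ha : totalRate c a = 0) {x : S}
    (hxa : x ≠ a) :
    ENNReal.ofReal (totalRate c x) * hitting q a x = jumpSum c T (hitting q a) x := by
  classical
  have ha' : exitRate q a = 0 := by rw [h.exitRate_eq, ha]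
  rcases (h.totalRate_nonneg x).eq_or_lt with h0 | hpos
  · simp [← h0, jumpSum, h.rate_eq_zero h0.symm]
  set l := totalRate c x
  have hl0 : ENNReal.ofReal l ≠ 0 := by simpa using hpos
  refine le_antisymm ?_ ?_
  -- After the first jump everything is bounded by the hitting probability; the remaining time
  -- integral is at most `1 / l`.
  · rw [hitting, ENNReal.mul_iSup]
    refine iSup_le fun m => ?_
    rcases m with _ | m
    · simp [transitionUpTo]
    · rw [h.transitionUpTo_succ, if_neg hxa, zero_add]
      calc _ ≤ ENNReal.ofReal l * ∫⁻ s in Set.Icc (0 : ℝ) (m + 1 : ℕ),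
            ENNReal.ofReal (Real.exp (-(l * s))) * jumpSum c T (hitting q a) x := by
              gcongr with s
              exact jumpSum_mono (fun z => transitionUpTo_le_hitting ha' _ _ _) x
        _ = ENNReal.ofReal l * ENNReal.ofReal ((1 - Real.exp (-(l * (m + 1 : ℕ)))) / l) *
            jumpSum c T (hitting q a) x := by
              rw [lintegral_mul_const _ (by fun_prop), lintegral_exp_Icc hpos (by positivity),
                mul_assoc]
        _ ≤ 1 * jumpSum c T (hitting q a) x := by
              gcongr
              rw [← ENNReal.ofReal_mul hpos.le]
              refine ENNReal.ofReal_le_one.2 ?_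
              rw [mul_div_cancel₀ _ hpos.ne']
              linarith [Real.exp_pos (-(l * (m + 1 : ℕ)))]
        _ = _ := one_mul _
  · have e : jumpSum c T (hitting q a) x =
        ⨆ m : ℕ, jumpSum c T (fun z => transitionUpTo q m m z a) x := by
      refine jumpSum_iSup (fun z m n hmn => ?_) x
      exact (transitionUpTo_mono_nat q _ z a hmn).trans
        (transitionUpTo_mono_time ha' _ z (by exact_mod_cast hmn))
    rw [e]
    refine iSup_le fun m => ?_
    set J := jumpSum c T (fun z => transitionUpTo q m m z a) x
    -- Within the horizon `u + m` only first jumps before time `u` are kept, so that at least time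
    -- `m` is left afterwards. The exponential disappears as `u → ∞`.
    have step : ∀ u : ℝ, 0 ≤ u →
        ENNReal.ofReal (1 - Real.exp (-(l * u))) * J ≤ ENNReal.ofReal l * hitting q a x := by
      intro u hu
      have h1 : ENNReal.ofReal ((1 - Real.exp (-(l * u))) / l) * J ≤ hitting q a x := by
        refine le_trans ?_ (transitionUpTo_le_hitting ha' (m + 1) (u + m) x)
        rw [h.transitionUpTo_succ, if_neg hxa, zero_add, ← lintegral_exp_Icc hpos hu,
          ← lintegral_mul_const _ (by fun_prop)]
        refine le_trans ?_ (lintegral_mono_set (Set.Icc_subset_Icc_right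
          (by linarith [Nat.cast_nonneg (α := ℝ) m] : u ≤ u + m)))
        refine setLIntegral_mono' measurableSet_Icc fun s hs => ?_
        gcongr
        refine jumpSum_mono (fun z => transitionUpTo_mono_time ha' _ _ ?_) x
        linarith [hs.2]
      calc _ = ENNReal.ofReal l * (ENNReal.ofReal ((1 - Real.exp (-(l * u))) / l) * J) := by
            rw [← mul_assoc, ← ENNReal.ofReal_mul hpos.le, mul_div_cancel₀ _ hpos.ne']
        _ ≤ _ := by gcongr
    have lim : Tendsto (fun u : ℝ => ENNReal.ofReal (1 - Real.exp (-(l * u))) * J) atTop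
        (𝓝 (ENNReal.ofReal (1 - 0) * J)) := by
      refine ENNReal.Tendsto.mul_const ?_ (Or.inl (by simp))
      refine ENNReal.tendsto_ofReal (tendsto_const_nhds.sub ?_)
      exact Real.tendsto_exp_neg_atTop_nhds_zero.comp (tendsto_id.const_mul_atTop hpos)
    simp only [sub_zero, ENNReal.ofReal_one, one_mul] at lim
    exact le_of_tendsto lim ((eventually_ge_atTop 0).mono step)

end FiniteJumps

/-! ### Comparison with supersolutions, and stationarity in terms of the generator. -/

section Stationary

variable {S ι : Type*} [Fintype ι] {q : S → S → ℝ} {c : ι → S → ℝ} {T : ι → S → S}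

/-- The lower integral is superadditive without measurability, so measurability of the transition
function in time is never needed for the comparison below. -/
lemma tsum_lintegral_le {α β : Type*} [MeasurableSpace α] (μ : Measure α) (f : β → α → ℝ≥0∞) :
    ∑' b, ∫⁻ a, f b a ∂μ ≤ ∫⁻ a, ∑' b, f b a ∂μ := by
  classical
  rw [ENNReal.tsum_eq_iSup_sum]
  refine iSup_le fun F => ?_
  refine le_trans ?_ (lintegral_mono fun a => ENNReal.sum_le_tsum F)
  induction F using Finset.induction_on with
  | empty => simp
  | insert b F hb ih =>
    simp only [Finset.sum_insert hb]
    exact (add_le_add_right ih _).trans (le_lintegral_add _ _)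

lemma tsum_iSup_of_monotone {β : Type*} {f : ℕ → β → ℝ≥0∞} (hf : ∀ b, Monotone fun n => f n b) :
    ∑' b, ⨆ n, f n b = ⨆ n, ∑' b, f n b := by
  simp only [ENNReal.tsum_eq_iSup_sum]
  rw [iSup_comm]
  exact iSup_congr fun F => ENNReal.finsetSum_iSup_of_monotone fun b => hf b

/-- Comparison of the chain with a supersolution of the backward equation. -/
lemma JumpRep.tsum_transitionUpTo_le (h : JumpRep q c T) {u u' : ℝ → S → ℝ}
    (hu : ∀ t x, HasDerivAt (fun s => u s x) (u' t x) t)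
    (hc : ∀ x, Continuous fun t => u' t x) (h0 : ∀ t x, 0 ≤ t → 0 ≤ u t x)
    (hs : ∀ t x, 0 ≤ t → ∑ i, c i x * u t (T i x) ≤ totalRate c x * u t x + u' t x)
    (n : ℕ) (t : ℝ) (ht : 0 ≤ t) (x : S) :
    ∑' y, transitionUpTo q n t x y * ENNReal.ofReal (u 0 y) ≤ ENNReal.ofReal (u t x) := by
  classical
  induction n generalizing t x with
  | zero => simp [transitionUpTo]
  | succ n ih =>
    set l := totalRate c x
    have hnn : ∀ s ∈ Set.Icc (0 : ℝ) t, 0 ≤ l * u (t - s) x + u' (t - s) x := fun s hs' =>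
      (Finset.sum_nonneg fun i _ => mul_nonneg (h.nonneg i x)
        (h0 _ _ (by linarith [hs'.2]))).trans (hs (t - s) x (by linarith [hs'.2]))
    -- Variation of constants: the time integral produced by the first-jump decomposition is the
    -- integral of an exact derivative, with boundary terms `u t x` and the no-jump contribution.
    have hder : ∀ s, HasDerivAt (fun s => -(Real.exp (-(l * s)) * u (t - s) x))
        (Real.exp (-(l * s)) * (l * u (t - s) x + u' (t - s) x)) s := by
      intro s
      have h2 : HasDerivAt (fun s => u (t - s) x) (-u' (t - s) x) s :=
        (hu (t - s) x).comp_const_sub t s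
      exact ((hasDerivAt_neg_mul l s).exp.mul h2).neg.congr_deriv (by ring)
    have hcu : Continuous fun s => u s x :=
      continuous_iff_continuousAt.2 fun s => (hu s x).continuousAt
    have hcont : Continuous fun s => Real.exp (-(l * s)) * (l * u (t - s) x + u' (t - s) x) := by
      have := hc x
      fun_prop
    have e : u t x - Real.exp (-(l * t)) * u 0 x =
        -(Real.exp (-(l * t)) * u (t - t) x) - -(Real.exp (-(l * 0)) * u (t - 0) x) := by
      simp; ring
    have hsub : 0 ≤ u t x - Real.exp (-(l * t)) * u 0 x := by
      rw [e, ← intervalIntegral.integral_eq_sub_of_hasDerivAt (fun s _ => hder s)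
        (hcont.intervalIntegrable _ _)]
      exact intervalIntegral.integral_nonneg ht fun s hs' =>
        mul_nonneg (Real.exp_pos _).le (hnn s hs')
    have key : ∑' y, (∫⁻ s in Set.Icc (0 : ℝ) t, ENNReal.ofReal (Real.exp (-(l * s))) *
          jumpSum c T (fun z => transitionUpTo q n (t - s) z y) x) * ENNReal.ofReal (u 0 y) ≤
        ENNReal.ofReal (u t x - Real.exp (-(l * t)) * u 0 x) := by
      have hint := lintegral_Icc_ofReal_deriv ht hder
        hcont (fun s hs' => mul_nonneg (Real.exp_pos _).le (hnn s hs'))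
      rw [e, ← hint]
      calc _ ≤ ∑' y, ∫⁻ s in Set.Icc (0 : ℝ) t, ENNReal.ofReal (Real.exp (-(l * s))) *
            jumpSum c T (fun z => transitionUpTo q n (t - s) z y) x * ENNReal.ofReal (u 0 y) :=
              ENNReal.tsum_le_tsum fun y => lintegral_mul_const_le _ _
        _ ≤ ∫⁻ s in Set.Icc (0 : ℝ) t, ∑' y, ENNReal.ofReal (Real.exp (-(l * s))) *
            jumpSum c T (fun z => transitionUpTo q n (t - s) z y) x * ENNReal.ofReal (u 0 y) :=
              tsum_lintegral_le _ _
        _ ≤ _ := by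
              refine setLIntegral_mono' measurableSet_Icc fun s hs' => ?_
              have hts : 0 ≤ t - s := by linarith [hs'.2]
              rw [ENNReal.ofReal_mul (Real.exp_pos _).le]
              simp only [mul_assoc]
              rw [ENNReal.tsum_mul_left]
              gcongr
              refine le_trans ?_ (ENNReal.ofReal_le_ofReal (hs (t - s) x hts))
              rw [ENNReal.ofReal_sum_of_nonneg fun i _ => mul_nonneg (h.nonneg i x) (h0 _ _ hts)]
              simp only [jumpSum, Finset.sum_mul]
              rw [Summable.tsum_finsetSum fun _ _ => ENNReal.summable]
              refine Finset.sum_le_sum fun i _ => ?_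
              simp only [mul_assoc]
              rw [ENNReal.tsum_mul_left, ENNReal.ofReal_mul (h.nonneg i x)]
              gcongr
              exact ih (t - s) hts (T i x)
    simp only [h.transitionUpTo_succ, add_mul]
    rw [ENNReal.tsum_add, tsum_eq_single x (fun y hy => by rw [if_neg hy.symm, zero_mul]),
      if_pos rfl, ← ENNReal.ofReal_mul (Real.exp_pos _).le]
    refine (add_le_add_right key _).trans ?_
    rw [← ENNReal.ofReal_add (mul_nonneg (Real.exp_pos _).le (h0 0 x le_rfl))]
    · exact ENNReal.ofReal_le_ofReal (by linarith)
    · exact hsub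

lemma JumpRep.tsum_transition_le (h : JumpRep q c T) {u u' : ℝ → S → ℝ}
    (hu : ∀ t x, HasDerivAt (fun s => u s x) (u' t x) t)
    (hc : ∀ x, Continuous fun t => u' t x) (h0 : ∀ t x, 0 ≤ t → 0 ≤ u t x)
    (hs : ∀ t x, 0 ≤ t → ∑ i, c i x * u t (T i x) ≤ totalRate c x * u t x + u' t x)
    (t : ℝ) (ht : 0 ≤ t) (x : S) :
    ∑' y, transition q t x y * ENNReal.ofReal (u 0 y) ≤ ENNReal.ofReal (u t x) := by
  simp only [transition, ENNReal.iSup_mul]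
  rw [tsum_iSup_of_monotone (f := fun n y => transitionUpTo q n t x y * ENNReal.ofReal (u 0 y))
    fun y m n hmn => mul_le_mul_left (transitionUpTo_mono_nat q t x y hmn) _]
  exact iSup_le fun n => h.tsum_transitionUpTo_le hu hc h0 hs n t ht x

lemma JumpRep.tsum_transition_le_one (h : JumpRep q c T) (t : ℝ) (ht : 0 ≤ t) (x : S) :
    ∑' y, transition q t x y ≤ 1 := by
  have := h.tsum_transition_le (u := fun _ _ => 1) (u' := fun _ _ => 0)
    (fun t x => hasDerivAt_const _ _) (fun x => continuous_const) (fun _ _ _ => zero_le_one)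
    (fun t x _ => by simp [totalRate]) t ht x
  simpa using this

lemma JumpRep.hitting_le_one (h : JumpRep q c T) (a x : S) : hitting q a x ≤ 1 :=
  iSup_le fun m => (le_iSup (fun n => transitionUpTo q n (m : ℝ) x a) m).trans
    ((ENNReal.le_tsum a).trans (h.tsum_transition_le_one m (Nat.cast_nonneg m) x))

/-- A Lyapunov function is bounded in mean along the chain. -/
lemma JumpRep.tsum_transition_lyapunov (h : JumpRep q c T) {V : S → ℝ} (hV : ∀ x, 0 ≤ V x)
    {κ C : ℝ} (hκ : 0 < κ) (hC : 0 ≤ C)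
    (hL : ∀ x, ∑ i, c i x * V (T i x) ≤ totalRate c x * V x + (C - κ * V x))
    (t : ℝ) (ht : 0 ≤ t) (x : S) :
    ∑' y, transition q t x y * ENNReal.ofReal (V y) ≤
      ENNReal.ofReal (Real.exp (-(κ * t)) * V x + C / κ) := by
  -- The supersolution is the solution of `m' = C - κ m` with `m 0 = V x`.
  have := h.tsum_transition_le
    (u := fun t x => Real.exp (-(κ * t)) * V x + C / κ * (1 - Real.exp (-(κ * t))))
    (u' := fun t x => Real.exp (-(κ * t)) * (C - κ * V x)) ?_ ?_ ?_ ?_ t ht x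
  · refine le_trans (le_of_eq ?_) (this.trans (ENNReal.ofReal_le_ofReal ?_))
    · simp
    · have := div_nonneg hC hκ.le
      nlinarith [Real.exp_pos (-(κ * t))]
  · intro t x
    have h1 := hasDerivAt_neg_mul κ t
    refine ((h1.exp.mul_const (V x)).add ((h1.exp.const_sub 1).const_mul (C / κ))).congr_deriv ?_
    field_simp
    ring
  · intro x; fun_prop
  · intro t x ht
    have : Real.exp (-(κ * t)) ≤ 1 := Real.exp_le_one_iff.2 (by nlinarith)
    have := div_nonneg hC hκ.le
    have := hV x
    have := Real.exp_pos (-(κ * t))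
    have : 0 ≤ 1 - Real.exp (-(κ * t)) := by linarith
    positivity
  · intro t x _
    have e : ∑ i, c i x * (Real.exp (-(κ * t)) * V (T i x) + C / κ * (1 - Real.exp (-(κ * t)))) =
        Real.exp (-(κ * t)) * ∑ i, c i x * V (T i x) +
          totalRate c x * (C / κ * (1 - Real.exp (-(κ * t)))) := by
      rw [totalRate, Finset.mul_sum, Finset.sum_mul, ← Finset.sum_add_distrib]
      exact Finset.sum_congr rfl fun i _ => by ring
    rw [e]
    have := mul_le_mul_of_nonneg_left (hL x) (Real.exp_pos (-(κ * t))).le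
    linarith

-- First-order expansion for small `t`: no jump, or one jump and then rest. The factor `exp (-(λ_x +
-- λ_y) t)`, with `λ` the total rate, is a lower bound valid for every jump time in `[0, t]`.
open Classical in
lemma JumpRep.le_transition (h : JumpRep q c T) (t : ℝ) (x y : S) :
    (if x = y then ENNReal.ofReal (Real.exp (-(totalRate c y * t))) else 0) +
      ENNReal.ofReal t * (ENNReal.ofReal (Real.exp (-((totalRate c x + totalRate c y) * t))) *
        jumpSum c T (Set.indicator {y} 1) x) ≤ transition q t x y := by
  refine le_trans ?_ (le_iSup _ 2)
  rw [h.transitionUpTo_succ]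
  refine add_le_add (by split_ifs with e <;> simp [e]) ?_
  calc _ = ∫⁻ s in Set.Icc (0 : ℝ) t,
        (ENNReal.ofReal (Real.exp (-((totalRate c x + totalRate c y) * t))) *
          jumpSum c T (Set.indicator {y} 1) x) := by
        simp [mul_comm]
    _ ≤ _ := by
        refine setLIntegral_mono' measurableSet_Icc fun s hs => ?_
        have hx := h.totalRate_nonneg x
        have hy := h.totalRate_nonneg y
        have e1 : ENNReal.ofReal (Real.exp (-((totalRate c x + totalRate c y) * t))) ≤
            ENNReal.ofReal (Real.exp (-(totalRate c x * s))) *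
              ENNReal.ofReal (Real.exp (-(totalRate c y * (t - s)))) := by
          rw [← ENNReal.ofReal_mul (Real.exp_pos _).le, ← Real.exp_add]
          refine ENNReal.ofReal_le_ofReal (Real.exp_le_exp.2 ?_)
          nlinarith [hs.1, hs.2, mul_le_mul_of_nonneg_left hs.2 hx, mul_nonneg hy hs.1]
        refine (mul_le_mul_left e1 _).trans ?_
        rw [mul_assoc]
        gcongr
        simp only [jumpSum, Finset.mul_sum]
        refine Finset.sum_le_sum fun i _ => ?_
        rw [mul_left_comm]
        gcongr
        by_cases hi : T i x = y
        · rw [h.transitionUpTo_succ]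
          simp [hi]
        · simp [hi]

lemma tsum_mul_jumpSum_indicator (g : S → ℝ≥0∞) (x : S) :
    ∑' y, g y * jumpSum c T (Set.indicator {y} 1) x = jumpSum c T g x := by
  classical
  simp only [jumpSum, Finset.mul_sum]
  rw [Summable.tsum_finsetSum fun _ _ => ENNReal.summable]
  refine Finset.sum_congr rfl fun i _ => ?_
  rw [tsum_eq_single (T i x)]
  · simp [mul_comm]
  · intro y hy
    simp [hy.symm]

variable [MeasurableSpace S] {μ : Measure S}

/-- The flow into a state does not exceed the flow out of it. -/
lemma JumpRep.flow_le (h : JumpRep q c T) [IsProbabilityMeasure μ] (hμ : IsStationary q μ)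
    (y : S) :
    ∑' x, μ {x} * jumpSum c T (Set.indicator {y} 1) x ≤
      μ {y} * ENNReal.ofReal (totalRate c y) := by
  classical
  set J := jumpSum c T (Set.indicator {y} 1)
  rw [ENNReal.tsum_eq_iSup_sum]
  refine iSup_le fun F => ?_
  have step : ∀ t : ℝ, 0 < t →
      ∑ x ∈ F, μ {x} * (ENNReal.ofReal (Real.exp (-((totalRate c x + totalRate c y) * t))) * J x) ≤
        μ {y} * ENNReal.ofReal (totalRate c y) := by
    intro t ht
    set A := ∑ x ∈ F,
      μ {x} * (ENNReal.ofReal (Real.exp (-((totalRate c x + totalRate c y) * t))) * J x)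
    set E := ENNReal.ofReal (Real.exp (-(totalRate c y * t)))
    -- Stationarity at time `t` with the small-time lower bound inserted; `h2` bounds the mass lost
    -- in the no-jump term by `1 - exp (-r) ≤ r`. Cancelling `μ {y} * E` and dividing by `t` gives
    -- `step`.
    have h1 : μ {y} * E + ENNReal.ofReal t * A ≤ μ {y} := by
      calc μ {y} * E + ENNReal.ofReal t * A
          ≤ ∑' x, μ {x} * (if x = y then E else 0) + ∑' x, ENNReal.ofReal t * (μ {x} *
            (ENNReal.ofReal (Real.exp (-((totalRate c x + totalRate c y) * t))) * J x)) := by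
              refine add_le_add ?_ ?_
              · rw [tsum_eq_single y (fun x hx => by simp [hx])]
                simp
              · rw [ENNReal.tsum_mul_left]
                gcongr
                exact ENNReal.sum_le_tsum F
        _ ≤ ∑' x, μ {x} * transition q t x y := by
              rw [← ENNReal.tsum_add]
              refine ENNReal.tsum_le_tsum fun x => ?_
              refine le_trans (le_of_eq ?_) (mul_le_mul_right (h.le_transition t x y) _)
              ring
        _ = μ {y} := hμ t ht.le y
    have h2 : μ {y} ≤ μ {y} * E + ENNReal.ofReal t * (μ {y} * ENNReal.ofReal (totalRate c y)) := by
      have : (1 : ℝ≥0∞) ≤ E + ENNReal.ofReal t * ENNReal.ofReal (totalRate c y) := by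
        rw [← ENNReal.ofReal_mul ht.le, ← ENNReal.ofReal_add (Real.exp_pos _).le
          (mul_nonneg ht.le (h.totalRate_nonneg y)), ← ENNReal.ofReal_one]
        refine ENNReal.ofReal_le_ofReal ?_
        linarith [Real.add_one_le_exp (-(totalRate c y * t))]
      calc μ {y} = μ {y} * 1 := (mul_one _).symm
        _ ≤ μ {y} * (E + ENNReal.ofReal t * ENNReal.ofReal (totalRate c y)) := by gcongr
        _ = _ := by ring
    have h3 := ENNReal.le_of_add_le_add_left
      (ENNReal.mul_ne_top (measure_ne_top μ _) ENNReal.ofReal_ne_top) (h1.trans h2)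
    exact (ENNReal.mul_le_mul_iff_right (by simpa using ht) ENNReal.ofReal_ne_top).1 h3
  have lim : Tendsto (fun t : ℝ => ∑ x ∈ F, μ {x} *
      (ENNReal.ofReal (Real.exp (-((totalRate c x + totalRate c y) * t))) * J x)) (𝓝[>] 0)
      (𝓝 (∑ x ∈ F, μ {x} *
      (ENNReal.ofReal (Real.exp (-((totalRate c x + totalRate c y) * 0))) * J x))) := by
    refine Tendsto.mono_left ?_ nhdsWithin_le_nhds
    refine tendsto_finsetSum _ fun x _ => ENNReal.Tendsto.const_mul
      (ENNReal.Tendsto.mul_const ?_ (Or.inl (by simp))) (Or.inr (measure_ne_top μ _))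
    exact ENNReal.tendsto_ofReal ((by fun_prop : Continuous fun t : ℝ =>
      Real.exp (-((totalRate c x + totalRate c y) * t))).tendsto 0)
  simp only [mul_zero, neg_zero, Real.exp_zero, ENNReal.ofReal_one, one_mul] at lim
  exact le_of_tendsto lim (eventually_nhdsWithin_of_forall fun t ht => step t ht)

variable [Countable S] [MeasurableSingletonClass S]

lemma IsStationary.lintegral_eq (hμ : IsStationary q μ) {t : ℝ} (ht : 0 ≤ t) (g : S → ℝ≥0∞) :
    ∫⁻ x, g x ∂μ = ∫⁻ x, ∑' y, transition q t x y * g y ∂μ := by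
  rw [lintegral_countable', lintegral_countable']
  calc _ = ∑' y, g y * ∑' x, μ {x} * transition q t x y := tsum_congr fun y => by rw [hμ t ht y]
    _ = ∑' x, ∑' y, g y * (μ {x} * transition q t x y) := by
        rw [ENNReal.tsum_comm]
        exact tsum_congr fun y => ENNReal.tsum_mul_left.symm
    _ = _ := by
        refine tsum_congr fun x => ?_
        rw [← ENNReal.tsum_mul_right]
        exact tsum_congr fun y => by ring

/-- A Lyapunov function is integrable with respect to a stationary probability measure. -/
lemma JumpRep.lintegral_lyapunov_le (h : JumpRep q c T) [IsProbabilityMeasure μ]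
    (hμ : IsStationary q μ) {V : S → ℝ} (hV : ∀ x, 0 ≤ V x)
    {κ C : ℝ} (hκ : 0 < κ) (hC : 0 ≤ C)
    (hL : ∀ x, ∑ i, c i x * V (T i x) ≤ totalRate c x * V x + (C - κ * V x)) :
    ∫⁻ x, ENNReal.ofReal (V x) ∂μ ≤ ENNReal.ofReal (C / κ) := by
  -- `V` is not known to be integrable beforehand, so stationarity is applied to the bounded
  -- truncation at `M`. The initial value decays as time tends to infinity, dominated by `M`, and
  -- `M` is removed by monotone convergence.
  have bound : ∀ M : ℕ, ∫⁻ x, min (ENNReal.ofReal (V x)) M ∂μ ≤ ENNReal.ofReal (C / κ) := by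
    intro M
    have step : ∀ n : ℕ, ∫⁻ x, min (ENNReal.ofReal (V x)) M ∂μ ≤
        ∫⁻ x, min (ENNReal.ofReal (Real.exp (-(κ * n)) * V x + C / κ)) M ∂μ := by
      intro n
      rw [hμ.lintegral_eq (Nat.cast_nonneg n)]
      refine lintegral_mono fun x => le_min ?_ ?_
      · refine le_trans (ENNReal.tsum_le_tsum fun y => ?_)
          (h.tsum_transition_lyapunov hV hκ hC hL n (Nat.cast_nonneg n) x)
        gcongr
        exact min_le_left _ _
      · calc _ ≤ ∑' y, transition q n x y * M := ENNReal.tsum_le_tsum fun y => by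
              gcongr; exact min_le_right _ _
          _ ≤ 1 * M := by
              rw [ENNReal.tsum_mul_right]
              gcongr
              exact h.tsum_transition_le_one n (Nat.cast_nonneg n) x
          _ = M := one_mul _
    have lim : Tendsto (fun n : ℕ =>
        ∫⁻ x, min (ENNReal.ofReal (Real.exp (-(κ * n)) * V x + C / κ)) M ∂μ) atTop
        (𝓝 (∫⁻ x, min (ENNReal.ofReal (0 * V x + C / κ)) M ∂μ)) := by
      refine tendsto_lintegral_of_dominated_convergence (fun _ => (M : ℝ≥0∞))
        (fun n => Measurable.of_discrete) (fun n => ae_of_all _ fun x => min_le_right _ _)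
        (by simp) (ae_of_all _ fun x => ?_)
      refine Tendsto.min (ENNReal.tendsto_ofReal (Tendsto.add_const _ (Tendsto.mul_const _ ?_)))
        tendsto_const_nhds
      exact Real.tendsto_exp_neg_atTop_nhds_zero.comp
        (tendsto_natCast_atTop_atTop.const_mul_atTop hκ)
    refine (ge_of_tendsto' lim step).trans ?_
    refine (lintegral_mono fun x => min_le_left _ _).trans ?_
    simp
  have e : ∀ x, ENNReal.ofReal (V x) = ⨆ M : ℕ, min (ENNReal.ofReal (V x)) M := by
    intro x
    refine le_antisymm ?_ (iSup_le fun M => min_le_left _ _)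
    obtain ⟨M, hM⟩ := ENNReal.exists_nat_gt (ENNReal.ofReal_ne_top (r := V x))
    exact le_trans (le_min le_rfl hM.le) (le_iSup (fun M : ℕ => min (ENNReal.ofReal (V x)) M) M)
  rw [lintegral_congr e, lintegral_iSup (fun n => Measurable.of_discrete)]
  · exact iSup_le bound
  · intro m n hmn x
    dsimp only
    gcongr

/-- Stationarity in terms of the generator, for nonnegative functions. -/
lemma JumpRep.lintegral_jumpSum (h : JumpRep q c T) [IsProbabilityMeasure μ]
    (hμ : IsStationary q μ) (hfin : ∫⁻ x, ENNReal.ofReal (totalRate c x) ∂μ ≠ ∞) (g : S → ℝ≥0∞) :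
    ∫⁻ x, jumpSum c T g x ∂μ = ∫⁻ x, ENNReal.ofReal (totalRate c x) * g x ∂μ := by
  set a : S → ℝ≥0∞ := fun y => ∑' x, μ {x} * jumpSum c T (Set.indicator {y} 1) x
  set b : S → ℝ≥0∞ := fun y => μ {y} * ENNReal.ofReal (totalRate c y)
  have ha : ∀ g : S → ℝ≥0∞, ∫⁻ x, jumpSum c T g x ∂μ = ∑' y, g y * a y := by
    intro g
    simp only [a, ← ENNReal.tsum_mul_left]
    rw [lintegral_countable', ENNReal.tsum_comm]
    refine tsum_congr fun x => ?_
    rw [← tsum_mul_jumpSum_indicator, ← ENNReal.tsum_mul_right]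
    exact tsum_congr fun y => by ring
  have hb : ∀ g : S → ℝ≥0∞,
      ∫⁻ x, ENNReal.ofReal (totalRate c x) * g x ∂μ = ∑' y, g y * b y := by
    intro g
    rw [lintegral_countable']
    exact tsum_congr fun y => by simp only [b]; ring
  have hab : ∀ y, a y ≤ b y := h.flow_le hμ
  -- Both flows have the same finite total, the mean jump rate, so the statewise inequality `a ≤ b`
  -- must be an equality everywhere.
  have htot : ∑' y, a y = ∑' y, b y := by
    have h1 := ha 1
    have h2 := hb 1
    simp only [Pi.one_apply, one_mul, mul_one] at h1 h2
    rw [← h1, ← h2]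
    refine lintegral_congr fun x => ?_
    simp [jumpSum, totalRate, ENNReal.ofReal_sum_of_nonneg fun i _ => h.nonneg i x]
  have hbfin : ∑' y, b y ≠ ∞ := by
    have h2 := hb 1
    simp only [Pi.one_apply, one_mul, mul_one] at h2
    rwa [← h2]
  have heq : ∀ y, a y = b y := by
    intro y
    by_contra hne
    exact (ENNReal.tsum_lt_tsum (htot ▸ hbfin) hab (lt_of_le_of_ne (hab y) hne)).ne htot
  rw [ha, hb]
  exact tsum_congr fun y => by rw [heq]

/-- Stationarity in terms of the generator. -/
lemma JumpRep.integral_generator_eq_zero (h : JumpRep q c T) [IsProbabilityMeasure μ]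
    (hμ : IsStationary q μ) (h1 : Integrable (totalRate c) μ) {f : S → ℝ}
    (h2 : Integrable (fun x => totalRate c x * f x) μ)
    (h3 : ∀ i, Integrable (fun x => c i x * f (T i x)) μ) :
    ∫ x, ∑ i, c i x * (f (T i x) - f x) ∂μ = 0 := by
  have hfin : ∫⁻ x, ENNReal.ofReal (totalRate c x) ∂μ ≠ ∞ := by
    have := h1.lintegral_lt_top
    exact this.ne
  -- Proved for nonnegative functions, then applied to the positive and negative parts of `f`.
  have pos : ∀ g : S → ℝ, (∀ x, 0 ≤ g x) →
      ∫ x, ∑ i, c i x * g (T i x) ∂μ = ∫ x, totalRate c x * g x ∂μ := by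
    intro g hg
    rw [integral_eq_lintegral_of_nonneg_ae (ae_of_all _ fun x => Finset.sum_nonneg fun i _ =>
        mul_nonneg (h.nonneg i x) (hg _)) Measurable.of_discrete.aestronglyMeasurable,
      integral_eq_lintegral_of_nonneg_ae (ae_of_all _ fun x =>
        mul_nonneg (h.totalRate_nonneg x) (hg _)) Measurable.of_discrete.aestronglyMeasurable]
    congr 1
    have := h.lintegral_jumpSum hμ hfin (fun x => ENNReal.ofReal (g x))
    refine Eq.trans (lintegral_congr fun x => ?_) (this.trans (lintegral_congr fun x => ?_))
    · rw [ENNReal.ofReal_sum_of_nonneg fun i _ => mul_nonneg (h.nonneg i x) (hg _)]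
      exact Finset.sum_congr rfl fun i _ => ENNReal.ofReal_mul (h.nonneg i x)
    · rw [ENNReal.ofReal_mul (h.totalRate_nonneg x)]
  have hp := pos (fun x => max (f x) 0) fun x => le_max_right _ _
  have hn := pos (fun x => max (-f x) 0) fun x => le_max_right _ _
  have hI : ∀ (w g : S → ℝ), (∀ x, 0 ≤ w x) → Integrable (fun x => w x * g x) μ →
      Integrable (fun x => w x * max (g x) 0) μ := by
    intro w g hw hi
    refine hi.pos_part.congr (ae_of_all _ fun x => ?_)
    simp [mul_max_of_nonneg _ _ (hw x)]
  have hfm : ∀ x, f x = max (f x) 0 - max (-f x) 0 := by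
    intro x
    rcases le_total 0 (f x) with hx | hx <;> simp [hx]
  have hni : ∀ i, Integrable (fun x => c i x * -f (T i x)) μ := fun i => by
    simpa using (h3 i).neg
  have hn2 : Integrable (fun x => totalRate c x * -f x) μ := by simpa using h2.neg
  have e : ∀ x, ∑ i, c i x * (f (T i x) - f x) =
      (∑ i, c i x * max (f (T i x)) 0 - ∑ i, c i x * max (-f (T i x)) 0) -
        (totalRate c x * max (f x) 0 - totalRate c x * max (-f x) 0) := by
    intro x
    rw [← Finset.sum_sub_distrib, ← mul_sub, ← hfm, totalRate, Finset.sum_mul,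
      ← Finset.sum_sub_distrib]
    refine Finset.sum_congr rfl fun i _ => ?_
    rw [← mul_sub, ← hfm, mul_sub]
  rw [integral_congr_ae (ae_of_all _ e), integral_sub, integral_sub, integral_sub, hp, hn, sub_self]
  · exact hI _ _ h.totalRate_nonneg h2
  · exact hI _ _ h.totalRate_nonneg hn2
  · exact integrable_finsetSum _ fun i _ => hI _ _ (h.nonneg i) (h3 i)
  · exact integrable_finsetSum _ fun i _ => hI _ _ (h.nonneg i) (hni i)
  · exact (integrable_finsetSum _ fun i _ => hI _ _ (h.nonneg i) (h3 i)).sub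
      (integrable_finsetSum _ fun i _ => hI _ _ (h.nonneg i) (hni i))
  · exact (hI _ _ h.totalRate_nonneg h2).sub (hI _ _ h.totalRate_nonneg hn2)

end Stationary

/-! ### The duality functions -/

section SingleSite

/-- The binomial transform `∑ j ≤ k, (k choose j) r ^ (k - j) f j`. -/
def binomTransform (r : ℝ) : ℕ → (ℕ → ℝ) → ℝ
  | 0, f => f 0
  | k + 1, f => binomTransform r k (fun j => f (j + 1)) + r * binomTransform r k f

lemma binomTransform_congr (r : ℝ) {k : ℕ} {f g : ℕ → ℝ} (h : ∀ j ≤ k, f j = g j) :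
    binomTransform r k f = binomTransform r k g := by
  induction k generalizing f g with
  | zero => exact h 0 le_rfl
  | succ k ih =>
    simp only [binomTransform]
    rw [ih fun j hj => h (j + 1) (by omega), ih fun j hj => h j (by omega)]

lemma binomTransform_add (r : ℝ) (k : ℕ) (f g : ℕ → ℝ) :
    binomTransform r k (fun j => f j + g j) = binomTransform r k f + binomTransform r k g := by
  induction k generalizing f g with
  | zero => rfl
  | succ k ih =>
    simp only [binomTransform]
    rw [ih, ih]; ring

lemma binomTransform_const_mul (r : ℝ) (k : ℕ) (b : ℝ) (f : ℕ → ℝ) :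
    binomTransform r k (fun j => b * f j) = b * binomTransform r k f := by
  induction k generalizing f with
  | zero => rfl
  | succ k ih =>
    simp only [binomTransform]
    rw [ih, ih]; ring

/-- Write `j = k - (k - j)` and use `(k - j) (k choose j) = k (k - 1 choose j)`. At `k = 0` the
truncated `k - 1` is harmless because of the factor `k`. -/
lemma binomTransform_id_mul (r : ℝ) (k : ℕ) (f : ℕ → ℝ) :
    binomTransform r k (fun j => j * f j) =
      k * binomTransform r k f - r * k * binomTransform r (k - 1) f := by
  induction k generalizing f with
  | zero => simp [binomTransform]
  | succ k ih =>
    have h1 : binomTransform r k (fun j => ((j + 1 : ℕ) : ℝ) * f (j + 1)) =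
        binomTransform r k (fun j => (j : ℝ) * f (j + 1)) +
          binomTransform r k fun j => f (j + 1) := by
      rw [← binomTransform_add]
      exact binomTransform_congr r fun j _ => by push_cast; ring
    simp only [binomTransform]
    rw [h1, ih fun j => f (j + 1), ih f]
    rcases k with _ | k
    · simp [binomTransform]
    · simp only [binomTransform, Nat.add_sub_cancel]
      push_cast
      ring

/-- Absorption identity `j (k choose j) = k (k - 1 choose j - 1)`. -/
lemma binomTransform_id_mul_pred (r : ℝ) (k : ℕ) (f : ℕ → ℝ) :
    binomTransform r k (fun j => j * f (j - 1)) = k * binomTransform r (k - 1) f := by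
  induction k with
  | zero => simp [binomTransform]
  | succ k ih =>
    have h1 : binomTransform r k (fun j => ((j + 1 : ℕ) : ℝ) * f (j + 1 - 1)) =
        binomTransform r k (fun j => (j : ℝ) * f j) + binomTransform r k f := by
      rw [← binomTransform_add]
      exact binomTransform_congr r fun j _ => by rw [Nat.add_sub_cancel]; push_cast; ring
    simp only [binomTransform]
    rw [h1, ih, binomTransform_id_mul, Nat.add_sub_cancel]
    push_cast
    ring

/-- The single-site classical duality polynomial `∏ j < k, (z - j) / (a + s j)`. -/
def dualPoly (s a : ℝ) : ℕ → ℝ → ℝ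
  | 0, _ => 1
  | k + 1, z => (z - k) / (a + s * k) * dualPoly s a k z

/-- The single-site duality polynomial with parameter `θ`. -/
def siteDual (s a θ : ℝ) (k : ℕ) (z : ℝ) : ℝ :=
  binomTransform (-θ) k fun j => dualPoly s a j z

/-- Falling factorials: `z * (z - 1) ⋯ (z - k)` can be grouped in two ways. -/
lemma dualPoly_sub_one (s a : ℝ) (k : ℕ) (z : ℝ) :
    z * dualPoly s a k (z - 1) = (z - k) * dualPoly s a k z := by
  induction k with
  | zero => simp [dualPoly]
  | succ k ih =>
    simp only [dualPoly]
    push_cast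
    linear_combination (z - 1 - k) / (a + s * k) * ih

lemma dualPoly_succ' (s a : ℝ) {k : ℕ} (h : a + s * k ≠ 0) (z : ℝ) :
    (a + s * k) * dualPoly s a (k + 1) z = (z - k) * dualPoly s a k z := by
  rw [dualPoly, ← mul_assoc, mul_div_cancel₀ _ h]

/-- For exclusion the denominator vanishes at `k = a`. The relation survives at integers `n ≤ k`,
where the falling factorial of length `k + 1` is zero too. -/
lemma dualPoly_succ (s a : ℝ) {k : ℕ} {n : ℕ} (h : a + s * k = 0 → n ≤ k) :
    (a + s * k) * dualPoly s a (k + 1) n = (n - k) * dualPoly s a k n := by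
  have hz : ∀ j, n < j → dualPoly s a j n = 0 := by
    intro j hj
    induction j with
    | zero => omega
    | succ j ih =>
      rcases (Nat.lt_succ_iff.1 hj).eq_or_lt with h | h
      · simp [dualPoly, h]
      · simp [dualPoly, ih h]
  by_cases h0 : a + s * k = 0
  · rcases (h h0).eq_or_lt with h1 | h1
    · simp [h0, h1]
    · simp [h0, hz k h1]
  · exact dualPoly_succ' s a h0 _

lemma dualPoly_add_one (s a : ℝ) {k : ℕ} (h : ∀ j < k, a + s * (j : ℕ) ≠ 0) (z : ℝ) :
    (a + s * z) * dualPoly s a k (z + 1) =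
      k * dualPoly s a (k - 1) z + (a + s * k + s * z) * dualPoly s a k z := by
  -- The discrete derivative of a falling factorial, normalised by the denominators.
  have key : ∀ k : ℕ, (∀ j ≤ k, a + s * (j : ℕ) ≠ 0) →
      (a + s * k) * dualPoly s a (k + 1) (z + 1) =
        (a + s * k) * dualPoly s a (k + 1) z + (k + 1) * dualPoly s a k z := by
    intro k
    induction k with
    | zero =>
      intro hk
      rw [dualPoly_succ' s a (hk 0 le_rfl), dualPoly_succ' s a (hk 0 le_rfl)]
      simp [dualPoly]
    | succ k ih =>
      intro hk
      have h0 := hk k (by omega)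
      have h1 := ih fun j hj => hk j (by omega)
      have h2 := dualPoly_succ' s a h0 z
      rw [dualPoly_succ' s a (hk _ le_rfl), dualPoly_succ' s a (hk _ le_rfl)]
      refine mul_left_cancel₀ h0 ?_
      push_cast
      linear_combination (z - k) * h1 - (k + 1) * h2
  rcases k with _ | k
  · simp [dualPoly]
  · have h0 := h k (by omega)
    have h1 := key k fun j hj => h j (by omega)
    have h2 := dualPoly_succ' s a h0 z
    refine mul_left_cancel₀ h0 ?_
    rw [Nat.add_sub_cancel]
    push_cast
    linear_combination (a + s * z) * h1 - s * (k + 1) * h2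

/-- This and the next two lemmas are the binomial transforms of the relations for `dualPoly`. They
express occupation, removal and addition in `η` through shifts in `ξ`; both generators are built
from these three operations. -/
lemma siteDual_occ (s a θ : ℝ) (k n : ℕ) :
    n * siteDual s a θ k n = k * siteDual s a θ k n + θ * (k * siteDual s a θ (k - 1) n) +
      n * siteDual s a θ k (n - 1 : ℕ) := by
  have h : (n : ℝ) * siteDual s a θ k (n - 1 : ℕ) = n * siteDual s a θ k n +
      -1 * binomTransform (-θ) k (fun j => j * dualPoly s a j n) := by
    simp only [siteDual]
    rw [← binomTransform_const_mul, ← binomTransform_const_mul, ← binomTransform_const_mul,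
      ← binomTransform_add]
    refine binomTransform_congr _ fun j _ => ?_
    have := dualPoly_sub_one s a j n
    rcases n with _ | n
    · push_cast at this ⊢
      linear_combination this
    · simp only [Nat.add_sub_cancel]
      push_cast at this ⊢
      rw [add_sub_cancel_right] at this
      linear_combination this
  rw [h, binomTransform_id_mul]
  simp only [siteDual]
  ring

lemma siteDual_remove (s a θ : ℝ) {k n : ℕ} (h : ∀ j ≤ k, a + s * j = 0 → n ≤ j) :
    n * siteDual s a θ k (n - 1 : ℕ) = (a + s * k) * siteDual s a θ (k + 1) n +
      θ * (a + 2 * s * k) * siteDual s a θ k n +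
      s * θ ^ 2 * (k * siteDual s a θ (k - 1) n) := by
  have e : (n : ℝ) * siteDual s a θ k (n - 1 : ℕ) =
      a * binomTransform (-θ) k (fun j => dualPoly s a (j + 1) n) +
      s * binomTransform (-θ) k (fun j => j * dualPoly s a (j + 1) n) := by
    simp only [siteDual]
    rw [← binomTransform_const_mul, ← binomTransform_const_mul, ← binomTransform_const_mul,
      ← binomTransform_add]
    refine binomTransform_congr _ fun j hj => ?_
    have h1 := dualPoly_sub_one s a j n
    have h2 := dualPoly_succ s a (h j hj)
    rcases n with _ | n
    · push_cast at *
      linear_combination h1 - h2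
    · simp only [Nat.add_sub_cancel]
      push_cast at *
      rw [add_sub_cancel_right] at h1
      linear_combination h1 - h2
  rw [e, binomTransform_id_mul]
  rcases k with _ | k
  · simp [siteDual, binomTransform]; ring
  · simp only [siteDual, binomTransform, Nat.add_sub_cancel]
    push_cast
    ring

lemma siteDual_add (s a θ : ℝ) {k : ℕ} (h : ∀ j < k, a + s * (j : ℕ) ≠ 0) (n : ℕ) :
    (a + s * n) * siteDual s a θ k (n + 1 : ℕ) = k * siteDual s a θ (k - 1) n +
      a * siteDual s a θ k n + 2 * s * (k * siteDual s a θ k n) +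
      2 * s * θ * (k * siteDual s a θ (k - 1) n) + s * (n * siteDual s a θ k (n - 1 : ℕ)) := by
  have e : (a + s * n) * siteDual s a θ k (n + 1 : ℕ) =
      binomTransform (-θ) k (fun j => j * dualPoly s a (j - 1) n) +
      ((a + s * n) * binomTransform (-θ) k (fun j => dualPoly s a j n) +
      s * binomTransform (-θ) k (fun j => j * dualPoly s a j n)) := by
    simp only [siteDual]
    rw [← binomTransform_const_mul, ← binomTransform_const_mul, ← binomTransform_const_mul,
      ← binomTransform_add, ← binomTransform_add]
    refine binomTransform_congr _ fun j hj => ?_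
    have := dualPoly_add_one s a (fun i hi => h i (hi.trans_le hj)) n
    push_cast
    linear_combination this
  have h2 := siteDual_occ s a θ k n
  rw [e, binomTransform_id_mul_pred (f := fun j => dualPoly s a j n),
    binomTransform_id_mul (f := fun j => dualPoly s a j n)]
  simp only [siteDual] at h2 ⊢
  linear_combination s * h2

lemma siteDual_zero (s a θ z : ℝ) : siteDual s a θ 0 z = 1 := rfl

lemma siteDual_one (s a θ z : ℝ) : siteDual s a θ 1 z = z / a - θ := by
  simp [siteDual, binomTransform, dualPoly]
  ring

lemma siteDual_param_zero (s a : ℝ) (k : ℕ) (z : ℝ) : siteDual s a 0 k z = dualPoly s a k z := by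
  have : ∀ f : ℕ → ℝ, binomTransform 0 k f = f k := by
    induction k with
    | zero => intro f; rfl
    | succ k ih => intro f; simp [binomTransform, ih]
  simp [siteDual, this]

end SingleSite

/-! ### Duality of the bulk, of the reservoirs and of the full generators. -/

section Duality

variable {N : ℕ} {σ : SignType} {G : Geometry N}

lemma rate_nonneg {n : ℕ} {a : ℕ} (h : σ = -1 → n ≤ a) : 0 ≤ (a : ℝ) + (σ : ℝ) * n := by
  rcases σ.trichotomy with rfl | rfl | rfl
  · have : (n : ℝ) ≤ a := by exact_mod_cast h rfl
    simp only [SignType.coe_neg_one]; linarith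
  · simp
  · simp; positivity

lemma rate_eq_zero {n : ℕ} {a : ℕ} (ha : 0 < a) (h : (a : ℝ) + (σ : ℝ) * n = 0) :
    σ = -1 ∧ n = a := by
  have ha' : (0 : ℝ) < a := by exact_mod_cast ha
  rcases σ.trichotomy with rfl | rfl | rfl
  · simp only [SignType.coe_neg_one] at h
    exact ⟨rfl, by exact_mod_cast (by linarith : (n : ℝ) = a)⟩
  · simp at h; omega
  · simp only [SignType.coe_one] at h
    have : (0 : ℝ) ≤ n := Nat.cast_nonneg n
    linarith

/-- The three relations between `siteDual` at neighbouring occupation numbers. -/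
lemma siteDual_relations (θ : ℝ) {a k n : ℕ} (ha : 0 < a) (hk : σ = -1 → k ≤ a)
    (hn : σ = -1 → n ≤ a) :
    (n * siteDual σ a θ k n = k * siteDual σ a θ k n + θ * (k * siteDual σ a θ (k - 1) n) +
      n * siteDual σ a θ k (n - 1 : ℕ)) ∧
    (n * siteDual σ a θ k (n - 1 : ℕ) = ((a : ℝ) + (σ : ℝ) * k) * siteDual σ a θ (k + 1) n +
      θ * (a + 2 * (σ : ℝ) * k) * siteDual σ a θ k n +
      (σ : ℝ) * θ ^ 2 * (k * siteDual σ a θ (k - 1) n)) ∧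
    (((a : ℝ) + (σ : ℝ) * n) * siteDual σ a θ k (n + 1 : ℕ) = k * siteDual σ a θ (k - 1) n +
      a * siteDual σ a θ k n + 2 * (σ : ℝ) * (k * siteDual σ a θ k n) +
      2 * (σ : ℝ) * θ * (k * siteDual σ a θ (k - 1) n) + (σ : ℝ) * (n * siteDual σ a θ k (n - 1 : ℕ))) := by
  refine ⟨siteDual_occ _ _ _ _ _, siteDual_remove _ _ _ fun j _ h0 => ?_,
    siteDual_add _ _ _ (fun j hj h0 => ?_) _⟩
  -- A denominator vanishes only for exclusion, at the capacity of the site, which neither `n` nor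
  -- `k` exceeds.
  · obtain ⟨h1, rfl⟩ := rate_eq_zero ha h0
    exact hn h1
  · obtain ⟨h1, rfl⟩ := rate_eq_zero ha h0
    exact absurd (hk h1) (by omega)

lemma prod_split_two (f : Fin N → ℝ) {x y : Fin N} (h : x ≠ y) :
    ∏ z, f z = f x * f y * ∏ z ∈ (Finset.univ.erase x).erase y, f z := by
  rw [mul_assoc, Finset.mul_prod_erase _ f (by simp [h.symm]),
    Finset.mul_prod_erase _ f (Finset.mem_univ x)]

lemma moveTo_apply_left {η : Fin N → ℕ} {x y : Fin N} (h : x ≠ y) :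
    moveTo η x y x = η x - 1 := by
  simp [moveTo, addAt, removeAt, h]

lemma moveTo_apply_right {η : Fin N → ℕ} {x y : Fin N} (h : x ≠ y) :
    moveTo η x y y = η y + 1 := by
  simp [moveTo, addAt, removeAt, h.symm]

lemma moveTo_apply_of_ne {η : Fin N → ℕ} {x y z : Fin N} (hx : z ≠ x) (hy : z ≠ y) :
    moveTo η x y z = η z := by
  simp [moveTo, addAt, removeAt, hx, hy]

lemma removeAt_apply_self (η : Fin N → ℕ) (x : Fin N) : removeAt η x x = η x - 1 := by
  simp [removeAt]

lemma removeAt_apply_of_ne {η : Fin N → ℕ} {x z : Fin N} (h : z ≠ x) : removeAt η x z = η z := by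
  simp [removeAt, h]

lemma addAt_apply_self (η : Fin N → ℕ) (x : Fin N) : addAt η x x = η x + 1 := by
  simp [addAt]

lemma addAt_apply_of_ne {η : Fin N → ℕ} {x z : Fin N} (h : z ≠ x) : addAt η x z = η z := by
  simp [addAt, h]

/-- The product over the sites of the single-site duality polynomials. -/
def bulkDual (σ : SignType) (G : Geometry N) (θ : ℝ) (η ξ : Fin N → ℕ) : ℝ :=
  ∏ x, siteDual σ (G.α x) θ (ξ x) (η x)

lemma bulkDual_moveTo (θ : ℝ) (η ξ : Fin N → ℕ) {x y : Fin N} (h : x ≠ y) :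
    bulkDual σ G θ (moveTo η x y) ξ =
      siteDual σ (G.α x) θ (ξ x) (η x - 1 : ℕ) * siteDual σ (G.α y) θ (ξ y) (η y + 1 : ℕ) *
        ∏ z ∈ (Finset.univ.erase x).erase y, siteDual σ (G.α z) θ (ξ z) (η z) := by
  rw [bulkDual, prod_split_two _ h, moveTo_apply_left h, moveTo_apply_right h]
  congr 1
  refine Finset.prod_congr rfl fun z hz => ?_
  simp only [Finset.mem_erase] at hz
  rw [moveTo_apply_of_ne hz.2.1 hz.1]

lemma bulkDual_moveTo_dual (θ : ℝ) (η ξ : Fin N → ℕ) {x y : Fin N} (h : x ≠ y) :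
    bulkDual σ G θ η (moveTo ξ x y) =
      siteDual σ (G.α x) θ (ξ x - 1) (η x) * siteDual σ (G.α y) θ (ξ y + 1) (η y) *
        ∏ z ∈ (Finset.univ.erase x).erase y, siteDual σ (G.α z) θ (ξ z) (η z) := by
  rw [bulkDual, prod_split_two _ h, moveTo_apply_left h, moveTo_apply_right h]
  congr 1
  refine Finset.prod_congr rfl fun z hz => ?_
  simp only [Finset.mem_erase] at hz
  rw [moveTo_apply_of_ne hz.2.1 hz.1]

/-- Duality along an edge is checked for the sum of its two directions. -/
lemma sum_eq_of_symm {A B : Fin N → Fin N → ℝ}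
    (h : ∀ x y, A x y + A y x = B x y + B y x) : ∑ x, ∑ y, A x y = ∑ x, ∑ y, B x y := by
  have e : ∀ A : Fin N → Fin N → ℝ,
      ∑ x, ∑ y, (A x y + A y x) = ∑ x, ∑ y, A x y + ∑ x, ∑ y, A x y := by
    intro A
    simp only [Finset.sum_add_distrib]
    rw [Finset.sum_comm (f := fun x y => A y x)]
  have := e A
  simp only [h, e B] at this
  linarith

/-- Self-duality of the bulk dynamics. -/
lemma bulkGenerator_bulkDual (θ : ℝ) {η ξ : Fin N → ℕ} (hη : σ = -1 → ∀ x, η x ≤ G.α x)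
    (hξ : σ = -1 → ∀ x, ξ x ≤ G.α x) :
    bulkGenerator σ G (fun η => bulkDual σ G θ η ξ) η =
      bulkGenerator σ G (fun ξ => bulkDual σ G θ η ξ) ξ := by
  unfold bulkGenerator
  refine sum_eq_of_symm fun x y => ?_
  rw [G.ω_symm y x]
  by_cases hxy : x = y
  · subst hxy
    simp [G.ω_self]
  obtain ⟨ax, bx, cx⟩ := siteDual_relations θ (G.α_pos x) (fun h => hξ h x) (fun h => hη h x)
  obtain ⟨ay, by', cy⟩ := siteDual_relations θ (G.α_pos y) (fun h => hξ h y) (fun h => hη h y)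
  have hD : bulkDual σ G θ η ξ = siteDual σ (G.α x) θ (ξ x) (η x) *
      siteDual σ (G.α y) θ (ξ y) (η y) *
        ∏ z ∈ (Finset.univ.erase x).erase y, siteDual σ (G.α z) θ (ξ z) (η z) :=
    prod_split_two _ hxy
  beta_reduce
  rw [bulkDual_moveTo θ η ξ hxy, bulkDual_moveTo θ η ξ (Ne.symm hxy),
    bulkDual_moveTo_dual θ η ξ hxy, bulkDual_moveTo_dual θ η ξ (Ne.symm hxy), hD,
    Finset.erase_right_comm (a := y)]
  clear hD
  -- The other sites contribute a common factor, and the shifted values at `x` and `y` enter only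
  -- through the relations of their own site; what remains is polynomial elimination.
  generalize (∏ z ∈ (Finset.univ.erase x).erase y, siteDual σ (G.α z) θ (ξ z) (η z)) = R
  generalize siteDual σ (G.α x) θ (ξ x) (η x - 1 : ℕ) = p at *
  generalize siteDual σ (G.α x) θ (ξ x) (η x + 1 : ℕ) = p' at *
  generalize siteDual σ (G.α y) θ (ξ y) (η y - 1 : ℕ) = r at *
  generalize siteDual σ (G.α y) θ (ξ y) (η y + 1 : ℕ) = r' at *
  generalize siteDual σ (G.α x) θ (ξ x) (η x) = e at *
  generalize siteDual σ (G.α x) θ (ξ x - 1) (η x) = em at *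
  generalize siteDual σ (G.α x) θ (ξ x + 1) (η x) = ep at *
  generalize siteDual σ (G.α y) θ (ξ y) (η y) = f at *
  generalize siteDual σ (G.α y) θ (ξ y - 1) (η y) = fm at *
  generalize siteDual σ (G.α y) θ (ξ y + 1) (η y) = fp at *
  generalize (η x : ℝ) = n at *
  generalize (η y : ℝ) = m at *
  generalize (ξ x : ℝ) = k at *
  generalize (ξ y : ℝ) = l at *
  generalize (G.α x : ℝ) = a at *
  generalize (G.α y : ℝ) = b at *
  generalize (σ : ℝ) = s at *
  linear_combination G.ω x y * R * (n * p * cy + m * r * cx - (b + s * m) * f * ax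
    - s * (k * e + θ * (k * em) + n * p) * ay - (a + s * n) * e * ay
    - s * (l * f + θ * (l * fm) + m * r) * ax + l * fm * bx + k * em * by')

/-- Duality of the dynamics with a reservoir. -/
lemma reservoirGenerator_bulkDual (aL θL θ : ℝ) (x : Fin N) {η ξ : Fin N → ℕ}
    (hη : σ = -1 → ∀ x, η x ≤ G.α x) (hξ : σ = -1 → ∀ x, ξ x ≤ G.α x) :
    reservoirGenerator σ G aL θL x (fun η => bulkDual σ G θ η ξ) η =
      aL * ξ x * ((θL - θ) * bulkDual σ G θ η (removeAt ξ x) - bulkDual σ G θ η ξ) := by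
  obtain ⟨ax, bx, cx⟩ := siteDual_relations θ (G.α_pos x) (fun h => hξ h x) (fun h => hη h x)
  have split : ∀ (η' ξ' : Fin N → ℕ), (∀ z, z ≠ x → η' z = η z) → (∀ z, z ≠ x → ξ' z = ξ z) →
      bulkDual σ G θ η' ξ' = siteDual σ (G.α x) θ (ξ' x) (η' x) *
        ∏ z ∈ Finset.univ.erase x, siteDual σ (G.α z) θ (ξ z) (η z) := by
    intro η' ξ' h1 h2
    rw [bulkDual, ← Finset.mul_prod_erase _ _ (Finset.mem_univ x)]
    congr 1
    refine Finset.prod_congr rfl fun z hz => ?_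
    rw [h1 z (Finset.ne_of_mem_erase hz), h2 z (Finset.ne_of_mem_erase hz)]
  unfold reservoirGenerator
  beta_reduce
  rw [split (removeAt η x) ξ (fun z hz => removeAt_apply_of_ne hz) fun _ _ => rfl,
    split (addAt η x) ξ (fun z hz => addAt_apply_of_ne hz) fun _ _ => rfl,
    split η (removeAt ξ x) (fun _ _ => rfl) (fun z hz => removeAt_apply_of_ne hz),
    split η ξ (fun _ _ => rfl) fun _ _ => rfl, removeAt_apply_self, addAt_apply_self,
    removeAt_apply_self]
  -- The removal relation is not used: a reservoir never raises the dual degree at `x`.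
  linear_combination (∏ z ∈ Finset.univ.erase x, siteDual σ (G.α z) θ (ξ z) (η z)) *
    (-aL * (1 + σ * θL) * ax + aL * θL * cx - aL * θL * σ * ax)

/-- The duality function with parameter `θ`; `θ = 0` is the classical one. -/
def dualFun (σ : SignType) (G : Geometry N) (θL θR θ : ℝ) (η : Fin N → ℕ)
    (ξ : (Fin N → ℕ) × ℕ × ℕ) : ℝ :=
  (θL - θ) ^ ξ.2.1 * (θR - θ) ^ ξ.2.2 * bulkDual σ G θ η ξ.1

lemma bulkGenerator_const_mul (b : ℝ) (f : (Fin N → ℕ) → ℝ) (η : Fin N → ℕ) :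
    bulkGenerator σ G (fun η => b * f η) η = b * bulkGenerator σ G f η := by
  simp only [bulkGenerator, Finset.mul_sum]
  refine Finset.sum_congr rfl fun x _ => Finset.sum_congr rfl fun y _ => by ring

lemma reservoirGenerator_const_mul (a θ : ℝ) (x : Fin N) (b : ℝ) (f : (Fin N → ℕ) → ℝ)
    (η : Fin N → ℕ) :
    reservoirGenerator σ G a θ x (fun η => b * f η) η = b * reservoirGenerator σ G a θ x f η := by
  simp only [reservoirGenerator]
  ring

/-- Duality between the boundary driven system and the dual system. -/
theorem generator_dualFun [NeZero N] (θL θR θ : ℝ) {η : Fin N → ℕ} {ξ : (Fin N → ℕ) × ℕ × ℕ}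
    (hη : σ = -1 → ∀ x, η x ≤ G.α x) (hξ : σ = -1 → ∀ x, ξ.1 x ≤ G.α x) :
    generator σ G θL θR (fun η => dualFun σ G θL θR θ η ξ) η =
      dualGenerator σ G (dualFun σ G θL θR θ η) ξ := by
  simp only [generator, dualGenerator, dualFun]
  rw [bulkGenerator_const_mul, reservoirGenerator_const_mul, reservoirGenerator_const_mul,
    bulkGenerator_const_mul, bulkGenerator_bulkDual θ hη hξ, reservoirGenerator_bulkDual _ _ _ _ hη hξ,
    reservoirGenerator_bulkDual _ _ _ _ hη hξ, pow_succ, pow_succ]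
  ring

end Duality

/-! ### The jumps of the two systems -/

section Jumps

variable {N : ℕ} {σ : SignType} {G : Geometry N}

/-- The rate of the jump of a particle from `i.1` to `i.2`. -/
def bulkRate (σ : SignType) (G : Geometry N) (i : Fin N × Fin N) (η : Fin N → ℕ) : ℝ :=
  G.ω i.1 i.2 * ((η i.1 : ℝ) * ((G.α i.2 : ℝ) + (σ : ℝ) * (η i.2 : ℝ)))

lemma bulkRate_nonneg (i : Fin N × Fin N) {η : Fin N → ℕ} (hη : σ = -1 → ∀ x, η x ≤ G.α x) :
    0 ≤ bulkRate σ G i η :=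
  mul_nonneg (G.ω_nonneg _ _) (mul_nonneg (Nat.cast_nonneg _) (rate_nonneg fun h => hη h _))

lemma bulkRate_ne_zero {x y : Fin N} {η : Fin N → ℕ} (h : bulkRate σ G (x, y) η ≠ 0) :
    x ≠ y ∧ η x ≠ 0 ∧ (G.α y : ℝ) + (σ : ℝ) * η y ≠ 0 := by
  simp only [bulkRate, ne_eq, mul_eq_zero, not_or, Nat.cast_eq_zero] at h
  refine ⟨?_, h.2.1, h.2.2⟩
  rintro rfl
  exact h.1 (G.ω_self x)

lemma addAt_valid {x : Fin N} {η : Fin N → ℕ} (hη : σ = -1 → ∀ x, η x ≤ G.α x)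
    (h : (G.α x : ℝ) + (σ : ℝ) * η x ≠ 0) : σ = -1 → ∀ z, addAt η x z ≤ G.α z := by
  rintro rfl z
  by_cases hz : z = x
  · subst hz
    rw [addAt_apply_self]
    refine lt_of_le_of_ne (hη rfl z) fun e => h ?_
    simp [e]
  · rw [addAt_apply_of_ne hz]
    exact hη rfl z

lemma removeAt_le (η : Fin N → ℕ) (x z : Fin N) : removeAt η x z ≤ η z := Nat.sub_le _ _

lemma removeAt_valid (x : Fin N) {η : Fin N → ℕ} (hη : σ = -1 → ∀ x, η x ≤ G.α x) :
    σ = -1 → ∀ z, removeAt η x z ≤ G.α z :=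
  fun h z => (removeAt_le η x z).trans (hη h z)

lemma moveTo_valid {x y : Fin N} {η : Fin N → ℕ} (hη : σ = -1 → ∀ x, η x ≤ G.α x)
    (h : bulkRate σ G (x, y) η ≠ 0) : σ = -1 → ∀ z, moveTo η x y z ≤ G.α z := by
  obtain ⟨hxy, -, h2⟩ := bulkRate_ne_zero h
  refine addAt_valid (removeAt_valid x hη) ?_
  rwa [removeAt_apply_of_ne hxy.symm]

lemma sum_addAt (η : Fin N → ℕ) (x : Fin N) : ∑ z, addAt η x z = ∑ z, η z + 1 := by
  simp [addAt, Finset.sum_add_distrib]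

lemma addAt_removeAt {η : Fin N → ℕ} {x : Fin N} (h : η x ≠ 0) : addAt (removeAt η x) x = η := by
  ext z
  by_cases hz : z = x
  · subst hz
    rw [addAt_apply_self, removeAt_apply_self]
    omega
  · rw [addAt_apply_of_ne hz, removeAt_apply_of_ne hz]

lemma sum_removeAt {η : Fin N → ℕ} {x : Fin N} (h : η x ≠ 0) :
    ∑ z, removeAt η x z + 1 = ∑ z, η z := by
  rw [← sum_addAt, addAt_removeAt h]

lemma sum_moveTo {η : Fin N → ℕ} {x : Fin N} (y : Fin N) (h : η x ≠ 0) :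
    ∑ z, moveTo η x y z = ∑ z, η z := by
  rw [moveTo, sum_addAt, sum_removeAt h]

lemma bulkGenerator_eq (f : (Fin N → ℕ) → ℝ) (η : Fin N → ℕ) :
    bulkGenerator σ G f η =
      ∑ i : Fin N × Fin N, bulkRate σ G i η * (f (moveTo η i.1 i.2) - f η) := by
  rw [Fintype.sum_prod_type]
  simp only [bulkGenerator, bulkRate, mul_assoc]

/-- The dual configurations with `n` particles. -/
def dualStates (σ : SignType) (G : Geometry N) (n : ℕ) : Set ((Fin N → ℕ) × ℕ × ℕ) :=
  {ξ | (σ = -1 → ∀ x, ξ.1 x ≤ G.α x) ∧ ξ.2.1 + ξ.2.2 + ∑ x, ξ.1 x = n}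

/-- Particle conservation bounds every coordinate by `n`. Finiteness provides the minima and the
finite-dimensional linear algebra used later. -/
lemma dualStates_finite (n : ℕ) : (dualStates σ G n).Finite := by
  refine ((Set.finite_Icc (0 : Fin N → ℕ) fun _ => n).prod
    ((Set.finite_Iic n).prod (Set.finite_Iic n))).subset ?_
  rintro ⟨ξ, l, r⟩ ⟨-, h⟩
  dsimp only at h
  refine ⟨⟨zero_le, fun x => ?_⟩, ?_, ?_⟩
  · have := Finset.single_le_sum (f := ξ) (fun _ _ => Nat.zero_le _) (Finset.mem_univ x)
    dsimp only
    omega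
  · simp only [Set.mem_Iic]; omega
  · simp only [Set.mem_Iic]; omega

/-- The dual configuration as an element of the ambient product. -/
def DualConfig.toProd (ξ : DualConfig σ G) : (Fin N → ℕ) × ℕ × ℕ := (ξ.1.1, ξ.2)

lemma DualConfig.toProd_injective :
    Function.Injective (DualConfig.toProd : DualConfig σ G → (Fin N → ℕ) × ℕ × ℕ) := by
  rintro ⟨ξ, l⟩ ⟨ξ', l'⟩ h
  simp only [DualConfig.toProd, Prod.mk.injEq] at h
  exact Prod.ext (Subtype.ext h.1) h.2

lemma DualConfig.toProd_mem (ξ : DualConfig σ G) : ξ.toProd ∈ dualStates σ G (size ξ) :=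
  ⟨ξ.1.2, rfl⟩

lemma size_eq_of_mem {ξ : DualConfig σ G} {n : ℕ} (h : ξ.toProd ∈ dualStates σ G n) :
    size ξ = n := h.2

lemma exists_toProd_eq {n : ℕ} {ξ : (Fin N → ℕ) × ℕ × ℕ} (h : ξ ∈ dualStates σ G n) :
    ∃ ξ' : DualConfig σ G, ξ'.toProd = ξ := ⟨(⟨ξ.1, h.1⟩, ξ.2), rfl⟩

variable [NeZero N]

/-- The rates of the jumps of the dual system. -/
def dualJumpRate (σ : SignType) (G : Geometry N) :
    (Fin N × Fin N) ⊕ Bool → (Fin N → ℕ) × ℕ × ℕ → ℝ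
  | .inl i, ξ => bulkRate σ G i ξ.1
  | .inr true, ξ => G.ωL * G.αL * ξ.1 (firstSite N)
  | .inr false, ξ => G.ωR * G.αR * ξ.1 (lastSite N)

/-- The jumps of the dual system. -/
def dualJump : (Fin N × Fin N) ⊕ Bool → (Fin N → ℕ) × ℕ × ℕ → (Fin N → ℕ) × ℕ × ℕ
  | .inl i, ξ => (moveTo ξ.1 i.1 i.2, ξ.2)
  | .inr true, ξ => (removeAt ξ.1 (firstSite N), ξ.2.1 + 1, ξ.2.2)
  | .inr false, ξ => (removeAt ξ.1 (lastSite N), ξ.2.1, ξ.2.2 + 1)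

lemma dualGenerator_eq (f : (Fin N → ℕ) × ℕ × ℕ → ℝ) (ξ : (Fin N → ℕ) × ℕ × ℕ) :
    dualGenerator σ G f ξ = ∑ i, dualJumpRate σ G i ξ * (f (dualJump i ξ) - f ξ) := by
  rw [Fintype.sum_sum_type, Fintype.sum_bool, dualGenerator, bulkGenerator_eq]
  rfl

lemma dualJumpRate_nonneg (i : (Fin N × Fin N) ⊕ Bool) {ξ : (Fin N → ℕ) × ℕ × ℕ}
    (hξ : σ = -1 → ∀ x, ξ.1 x ≤ G.α x) : 0 ≤ dualJumpRate σ G i ξ := by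
  have h1 := G.αL_pos
  have h2 := G.αR_pos
  have h3 := G.ωL_nonneg
  have h4 := G.ωR_nonneg
  rcases i with i | _ | _
  · exact bulkRate_nonneg i hξ
  · simp only [dualJumpRate]; positivity
  · simp only [dualJumpRate]; positivity

lemma dualJump_mem {n : ℕ} {i : (Fin N × Fin N) ⊕ Bool} {ξ : (Fin N → ℕ) × ℕ × ℕ}
    (hξ : ξ ∈ dualStates σ G n) (hi : dualJumpRate σ G i ξ ≠ 0) :
    dualJump i ξ ∈ dualStates σ G n := by
  obtain ⟨h1, h2⟩ := hξ
  rcases i with ⟨x, y⟩ | _ | _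
  · refine ⟨moveTo_valid h1 hi, ?_⟩
    simp only [dualJump]
    rw [sum_moveTo _ (bulkRate_ne_zero hi).2.1]
    exact h2
  · refine ⟨removeAt_valid _ h1, ?_⟩
    simp only [dualJumpRate, ne_eq, mul_eq_zero, not_or, Nat.cast_eq_zero] at hi
    have := sum_removeAt hi.2
    simp only [dualJump]
    omega
  · refine ⟨removeAt_valid _ h1, ?_⟩
    simp only [dualJumpRate, ne_eq, mul_eq_zero, not_or, Nat.cast_eq_zero] at hi
    have := sum_removeAt hi.2
    simp only [dualJump]
    omega

lemma dualJump_ne {i : (Fin N × Fin N) ⊕ Bool} {ξ : (Fin N → ℕ) × ℕ × ℕ}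
    (hi : dualJumpRate σ G i ξ ≠ 0) : dualJump i ξ ≠ ξ := by
  intro e
  rcases i with ⟨x, y⟩ | _ | _
  · obtain ⟨h1, h2, -⟩ := bulkRate_ne_zero hi
    have := congrFun (congrArg Prod.fst e) x
    simp only [dualJump] at this
    rw [moveTo_apply_left h1] at this
    omega
  · have := congrArg (fun ξ => ξ.2.2) e
    simp [dualJump] at this
  · have := congrArg (fun ξ => ξ.2.1) e
    simp [dualJump] at this

/-- Jumps that leave the level have rate zero, so the generator sees only values on the level. -/
lemma dualGenerator_congr {n : ℕ} {f g : (Fin N → ℕ) × ℕ × ℕ → ℝ}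
    (h : ∀ ξ ∈ dualStates σ G n, f ξ = g ξ) {ξ : (Fin N → ℕ) × ℕ × ℕ}
    (hξ : ξ ∈ dualStates σ G n) : dualGenerator σ G f ξ = dualGenerator σ G g ξ := by
  rw [dualGenerator_eq, dualGenerator_eq]
  refine Finset.sum_congr rfl fun i _ => ?_
  by_cases hi : dualJumpRate σ G i ξ = 0
  · simp [hi]
  · rw [h _ hξ, h _ (dualJump_mem hξ hi)]

/-! ### Absorption and the minimum principle -/

/-- Along jumps of positive rate the dual system reaches an absorbed configuration. -/
lemma exists_absorbed_mem {P : Set ((Fin N → ℕ) × ℕ × ℕ)}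
    (hP : ∀ ξ ∈ P, ∀ i, 0 < dualJumpRate σ G i ξ → dualJump i ξ ∈ P)
    {ξ : (Fin N → ℕ) × ℕ × ℕ} (hξ : ξ ∈ P) : ∃ ξ' ∈ P, ξ'.1 = 0 := by
  have exit : ∃ (b : Fin N) (i : Bool), ∀ ξ : (Fin N → ℕ) × ℕ × ℕ, ξ.1 b ≠ 0 →
      0 < dualJumpRate σ G (.inr i) ξ ∧ (dualJump (.inr i) ξ).1 = removeAt ξ.1 b := by
    rcases G.ω_boundary with h | h
    · refine ⟨firstSite N, true, fun ξ hb => ⟨?_, rfl⟩⟩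
      have : (0 : ℝ) < ξ.1 (firstSite N) := by exact_mod_cast Nat.pos_of_ne_zero hb
      exact mul_pos (mul_pos h G.αL_pos) this
    · refine ⟨lastSite N, false, fun ξ hb => ⟨?_, rfl⟩⟩
      have : (0 : ℝ) < ξ.1 (lastSite N) := by exact_mod_cast Nat.pos_of_ne_zero hb
      exact mul_pos (mul_pos h G.αR_pos) this
  obtain ⟨b, i, hbi⟩ := exit
  -- Outer induction on the number of particles still in `V`; the inner one follows a path from an
  -- occupied site to the exit site `b`.
  induction hm : ∑ x, ξ.1 x using Nat.strong_induction_on generalizing ξ with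
  | _ m ih =>
    by_cases h0 : ξ.1 = 0
    · exact ⟨ξ, hξ, h0⟩
    obtain ⟨x, hx⟩ := Function.ne_iff.1 h0
    obtain ⟨w⟩ := G.connected x b
    induction w generalizing ξ with
    | nil =>
      obtain ⟨h1, h2⟩ := hbi ξ hx
      have := sum_removeAt hx
      refine ih (∑ z, (dualJump (.inr i) ξ).1 z) ?_ (hP ξ hξ _ h1) rfl
      rw [h2]
      omega
    | @cons x y _ hadj w ihw =>
      -- An empty next site accepts the particle even under exclusion. If it is occupied nothing
      -- moves, and the path is continued with the particle already there.
      by_cases hy : ξ.1 y = 0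
      · have hxy : G.ω x y ≠ 0 := by
          rw [SimpleGraph.fromRel_adj] at hadj
          rcases hadj.2 with h | h
          · exact h
          · rwa [G.ω_symm]
        have hx' : (0 : ℝ) < ξ.1 x := by exact_mod_cast Nat.pos_of_ne_zero hx
        have hα : (0 : ℝ) < G.α y := by exact_mod_cast G.α_pos y
        have hr : 0 < dualJumpRate σ G (.inl (x, y)) ξ := by
          simp only [dualJumpRate, bulkRate, hy, Nat.cast_zero, mul_zero, add_zero]
          exact mul_pos (lt_of_le_of_ne (G.ω_nonneg _ _) hxy.symm) (mul_pos hx' hα)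
        have hy' : (dualJump (.inl (x, y)) ξ).1 y ≠ 0 := by
          simp only [dualJump]
          rw [moveTo_apply_right hadj.ne]
          omega
        refine ihw hbi (hP ξ hξ _ hr) ?_ (fun e => hy' (by rw [e]; rfl)) hy'
        simp only [dualJump]
        rw [sum_moveTo _ hx, hm]
      · exact ihw hbi hξ hm h0 hy

/-- The minimum principle. -/
lemma nonneg_of_superharmonic {n : ℕ} {f : (Fin N → ℕ) × ℕ × ℕ → ℝ}
    (h : ∀ ξ ∈ dualStates σ G n, ξ.1 ≠ 0 → dualGenerator σ G f ξ ≤ 0)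
    (h0 : ∀ ξ ∈ dualStates σ G n, ξ.1 = 0 → 0 ≤ f ξ) :
    ∀ ξ ∈ dualStates σ G n, 0 ≤ f ξ := by
  intro ξ₁ hξ₁
  obtain ⟨ξ₀, hξ₀, hmin⟩ := Set.exists_min_image _ f (dualStates_finite (σ := σ) (G := G) n)
    ⟨ξ₁, hξ₁⟩
  refine le_trans ?_ (hmin ξ₁ hξ₁)
  by_contra! hneg
  -- At a minimiser with negative value all terms of the generator are nonnegative while their sum
  -- is not positive, so every accessible neighbour is again a minimiser. An absorbed minimiser then
  -- contradicts `h0`.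
  have closed : ∀ ξ ∈ {ξ | ξ ∈ dualStates σ G n ∧ f ξ = f ξ₀}, ∀ i, 0 < dualJumpRate σ G i ξ →
      dualJump i ξ ∈ {ξ | ξ ∈ dualStates σ G n ∧ f ξ = f ξ₀} := by
    rintro ξ ⟨hξ, hf⟩ i hi
    have hne : ξ.1 ≠ 0 := fun hz => by
      have := h0 ξ hξ hz
      linarith
    have hle := h ξ hξ hne
    rw [dualGenerator_eq] at hle
    have hterm : ∀ j ∈ Finset.univ, 0 ≤ dualJumpRate σ G j ξ * (f (dualJump j ξ) - f ξ) := by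
      intro j _
      by_cases hj : dualJumpRate σ G j ξ = 0
      · simp [hj]
      · refine mul_nonneg (dualJumpRate_nonneg j hξ.1) ?_
        rw [hf]
        exact sub_nonneg.2 (hmin _ (dualJump_mem hξ hj))
    have hzero := (Finset.sum_eq_zero_iff_of_nonneg hterm).1
      (le_antisymm hle (Finset.sum_nonneg hterm)) i (Finset.mem_univ i)
    have hmem := dualJump_mem hξ hi.ne'
    refine ⟨hmem, ?_⟩
    rcases mul_eq_zero.1 hzero with e | e
    · exact absurd e hi.ne'
    · linarith
  obtain ⟨ξ, ⟨hξ, hf⟩, hz⟩ := exists_absorbed_mem closed ⟨hξ₀, rfl⟩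
  have := h0 ξ hξ hz
  linarith

lemma dualGenerator_sub (f g : (Fin N → ℕ) × ℕ × ℕ → ℝ) (ξ : (Fin N → ℕ) × ℕ × ℕ) :
    dualGenerator σ G (fun ξ => f ξ - g ξ) ξ = dualGenerator σ G f ξ - dualGenerator σ G g ξ := by
  simp only [dualGenerator_eq, ← Finset.sum_sub_distrib]
  exact Finset.sum_congr rfl fun i _ => by ring

lemma dualGenerator_const_mul (b : ℝ) (f : (Fin N → ℕ) × ℕ × ℕ → ℝ)
    (ξ : (Fin N → ℕ) × ℕ × ℕ) :
    dualGenerator σ G (fun ξ => b * f ξ) ξ = b * dualGenerator σ G f ξ := by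
  simp only [dualGenerator_eq, Finset.mul_sum]
  exact Finset.sum_congr rfl fun i _ => by ring

/-- Harmonic functions are determined by their values at absorbed configurations. -/
lemma eq_of_harmonic {n : ℕ} {f g : (Fin N → ℕ) × ℕ × ℕ → ℝ}
    (hf : ∀ ξ ∈ dualStates σ G n, ξ.1 ≠ 0 → dualGenerator σ G f ξ = 0)
    (hg : ∀ ξ ∈ dualStates σ G n, ξ.1 ≠ 0 → dualGenerator σ G g ξ = 0)
    (h0 : ∀ ξ ∈ dualStates σ G n, ξ.1 = 0 → f ξ = g ξ) :
    ∀ ξ ∈ dualStates σ G n, f ξ = g ξ := by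
  intro ξ hξ
  refine le_antisymm (sub_nonneg.1 ?_) (sub_nonneg.1 ?_)
  · exact nonneg_of_superharmonic (f := fun ξ => g ξ - f ξ)
      (fun ξ hξ h => by rw [dualGenerator_sub, hf ξ hξ h, hg ξ hξ h, sub_zero])
      (fun ξ hξ h => by rw [h0 ξ hξ h, sub_self]) ξ hξ
  · exact nonneg_of_superharmonic (f := fun ξ => f ξ - g ξ)
      (fun ξ hξ h => by rw [dualGenerator_sub, hf ξ hξ h, hg ξ hξ h, sub_zero])
      (fun ξ hξ h => by rw [h0 ξ hξ h, sub_self]) ξ hξ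

/-! ### Absorption probabilities -/

open Classical in
/-- The jumps of the dual system on its configuration space. -/
def dualConfigJump (i : (Fin N × Fin N) ⊕ Bool) (ξ : DualConfig σ G) : DualConfig σ G :=
  if h : σ = -1 → ∀ x, (dualJump i ξ.toProd).1 x ≤ G.α x then
    (⟨(dualJump i ξ.toProd).1, h⟩, (dualJump i ξ.toProd).2)
  else ξ

lemma toProd_dualConfigJump {i : (Fin N × Fin N) ⊕ Bool} {ξ : DualConfig σ G}
    (hi : dualJumpRate σ G i ξ.toProd ≠ 0) :
    (dualConfigJump i ξ).toProd = dualJump i ξ.toProd := by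
  rw [dualConfigJump, dif_pos (dualJump_mem ξ.toProd_mem hi).1]
  rfl

lemma dualRate_jumpRep : JumpRep (dualRate σ G)
    (fun i ξ => dualJumpRate σ G i (DualConfig.toProd ξ)) dualConfigJump where
  nonneg i ξ := dualJumpRate_nonneg i ξ.1.2
  ne i ξ hi e := dualJump_ne hi (by rw [← toProd_dualConfigJump hi, e])
  rate ξ ξ' hne := by
    classical
    rw [dualRate, dualGenerator_eq]
    refine Finset.sum_congr rfl fun i _ => ?_
    change dualJumpRate σ G i ξ.toProd * (Set.indicator {ξ'.toProd} 1 (dualJump i ξ.toProd) -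
      Set.indicator {ξ'.toProd} 1 ξ.toProd) = _
    have h1 : ξ.toProd ≠ ξ'.toProd := fun e => hne (DualConfig.toProd_injective e)
    by_cases hi : dualJumpRate σ G i ξ.toProd = 0
    · simp [hi]
    · rw [← toProd_dualConfigJump hi]
      by_cases h2 : dualConfigJump i ξ = ξ'
      · simp [h1, h2]
      · have h3 : (dualConfigJump i ξ).toProd ≠ ξ'.toProd :=
          fun e => h2 (DualConfig.toProd_injective e)
        simp [h1, h2, h3]

lemma dualJumpRate_of_absorbed {ξ : (Fin N → ℕ) × ℕ × ℕ} (h : ξ.1 = 0)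
    (i : (Fin N × Fin N) ⊕ Bool) : dualJumpRate σ G i ξ = 0 := by
  rcases i with i | _ | _ <;> simp [dualJumpRate, bulkRate, h]

lemma totalRate_of_absorbed {ξ : DualConfig σ G} (h : ξ.1.1 = 0) :
    totalRate (fun i ξ => dualJumpRate σ G i (DualConfig.toProd ξ)) ξ = 0 :=
  Finset.sum_eq_zero fun i _ => dualJumpRate_of_absorbed (ξ := ξ.toProd) h i

lemma tendsto_absorbedLeft (ξ : DualConfig σ G) :
    Tendsto (fun t : ℝ => transition (dualRate σ G) t ξ (allLeft σ G (size ξ))) atTop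
      (𝓝 (absorbedLeft σ G ξ)) := by
  refine tendsto_nhds_limUnder ⟨_, tendsto_transition_hitting ?_ ξ⟩
  rw [dualRate_jumpRep.exitRate_eq]
  exact totalRate_of_absorbed rfl

lemma absorbedLeft_eq (ξ : DualConfig σ G) :
    absorbedLeft σ G ξ = hitting (dualRate σ G) (allLeft σ G (size ξ)) ξ := by
  refine tendsto_nhds_unique (tendsto_absorbedLeft ξ) (tendsto_transition_hitting ?_ ξ)
  rw [dualRate_jumpRep.exitRate_eq]
  exact totalRate_of_absorbed rfl

open Classical in
/-- The absorption probabilities as a function on the ambient product. -/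
def absorption (σ : SignType) (G : Geometry N) (ξ : (Fin N → ℕ) × ℕ × ℕ) : ℝ :=
  if h : σ = -1 → ∀ x, ξ.1 x ≤ G.α x then (absorbedLeft σ G (⟨ξ.1, h⟩, ξ.2)).toReal else 0

lemma absorption_toProd (ξ : DualConfig σ G) :
    absorption σ G ξ.toProd = (absorbedLeft σ G ξ).toReal := by
  rw [absorption, dif_pos (c := σ = -1 → ∀ x, ξ.toProd.1 x ≤ G.α x) ξ.1.2]
  rfl

/-- Harmonicity of the hitting probability, read in real numbers. Conservation of `size` keeps the
target `allLeft σ G n` the same after each jump. -/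
lemma dualGenerator_absorption {n : ℕ} {ξ : (Fin N → ℕ) × ℕ × ℕ} (hξ : ξ ∈ dualStates σ G n)
    (h0 : ξ.1 ≠ 0) : dualGenerator σ G (absorption σ G) ξ = 0 := by
  obtain ⟨ξ, rfl⟩ := exists_toProd_eq hξ
  have hn := size_eq_of_mem hξ
  have hfin : ∀ ξ : DualConfig σ G, hitting (dualRate σ G) (allLeft σ G n) ξ ≠ ∞ := fun ξ =>
    ne_top_of_le_ne_top ENNReal.one_ne_top (dualRate_jumpRep.hitting_le_one _ _)
  have hne : ξ ≠ allLeft σ G n := by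
    rintro rfl
    exact h0 rfl
  have hh := congrArg ENNReal.toReal
    (dualRate_jumpRep.hitting_harmonic (totalRate_of_absorbed (σ := σ) (G := G)
      (ξ := allLeft σ G n) rfl) hne)
  rw [jumpSum, ENNReal.toReal_mul, ENNReal.toReal_sum fun i _ =>
    ENNReal.mul_ne_top ENNReal.ofReal_ne_top (hfin _),
    ENNReal.toReal_ofReal (dualRate_jumpRep.totalRate_nonneg ξ)] at hh
  rw [dualGenerator_eq]
  simp only [mul_sub, Finset.sum_sub_distrib]
  rw [← Finset.sum_mul, absorption_toProd, absorbedLeft_eq, hn]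
  rw [totalRate] at hh
  rw [hh, sub_eq_zero]
  refine Finset.sum_congr rfl fun i _ => ?_
  rw [ENNReal.toReal_mul, ENNReal.toReal_ofReal (dualJumpRate_nonneg i ξ.1.2)]
  by_cases hi : dualJumpRate σ G i ξ.toProd = 0
  · simp [hi]
  · have hm := dualJump_mem hξ hi
    rw [← toProd_dualConfigJump hi] at hm ⊢
    rw [absorption_toProd, absorbedLeft_eq, size_eq_of_mem hm]

/-- With `0 ^ 0 = 1`, the right side is the indicator that no particle is in `R`. -/
lemma absorption_of_absorbed {ξ : (Fin N → ℕ) × ℕ × ℕ} (h0 : ξ.1 = 0) :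
    absorption σ G ξ = 0 ^ ξ.2.2 := by
  obtain ⟨ξ, rfl⟩ := exists_toProd_eq (σ := σ) (G := G) (ξ := ξ)
    (n := ξ.2.1 + ξ.2.2 + ∑ x, ξ.1 x) ⟨fun _ x => by simp [h0], rfl⟩
  obtain ⟨⟨η, hη⟩, l, r⟩ := ξ
  obtain rfl : η = 0 := h0
  rw [absorption_toProd, absorbedLeft_eq]
  simp only [DualConfig.toProd]
  have hs : size ((⟨0, hη⟩, l, r) : DualConfig σ G) = l + r := by simp [size]
  rw [hs]
  have ha := totalRate_of_absorbed (σ := σ) (G := G) (ξ := allLeft σ G (l + r)) rfl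
  rcases Nat.eq_zero_or_pos r with rfl | hr
  · have : hitting (dualRate σ G) (allLeft σ G (l + 0)) (⟨0, hη⟩, l, 0) = 1 :=
      le_antisymm (dualRate_jumpRep.hitting_le_one _ _) (dualRate_jumpRep.hitting_self ha)
    rw [this]
    simp
  · rw [dualRate_jumpRep.hitting_of_absorbing (totalRate_of_absorbed rfl)]
    · simp [hr.ne']
    · intro e
      have := congrArg (fun ξ => ξ.2.2) e
      simp only [allLeft] at this
      omega

end Jumps

/-! ### Moments of stationary measures -/

section Moments

variable {N : ℕ} {σ : SignType} {G : Geometry N}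

open Classical in
/-- The dual configurations with `n` particles which are not absorbed. -/
def activeStates (σ : SignType) (G : Geometry N) (n : ℕ) : Finset ((Fin N → ℕ) × ℕ × ℕ) :=
  (dualStates_finite (σ := σ) (G := G) n).toFinset.filter fun ξ => ξ.1 ≠ 0

lemma mem_activeStates {n : ℕ} {ξ : (Fin N → ℕ) × ℕ × ℕ} :
    ξ ∈ activeStates σ G n ↔ ξ ∈ dualStates σ G n ∧ ξ.1 ≠ 0 := by
  simp [activeStates]

open Classical in
/-- Extension by zero of a function of the active configurations. -/
def extendZero {n : ℕ} (g : activeStates σ G n → ℝ) (ξ : (Fin N → ℕ) × ℕ × ℕ) : ℝ :=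
  if h : ξ ∈ activeStates σ G n then g ⟨ξ, h⟩ else 0

lemma extendZero_coe {n : ℕ} (g : activeStates σ G n → ℝ) (ξ : activeStates σ G n) :
    extendZero g ξ = g ξ := dif_pos ξ.2

lemma extendZero_of_absorbed {n : ℕ} (g : activeStates σ G n → ℝ) {ξ : (Fin N → ℕ) × ℕ × ℕ}
    (h : ξ.1 = 0) : extendZero g ξ = 0 :=
  dif_neg fun h' => (mem_activeStates.1 h').2 h

/-! ### Green's function of the dual chain killed at absorption. -/

section Green

variable [NeZero N]

lemma dualGenerator_add (f g : (Fin N → ℕ) × ℕ × ℕ → ℝ) (ξ : (Fin N → ℕ) × ℕ × ℕ) :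
    dualGenerator σ G (fun ξ => f ξ + g ξ) ξ = dualGenerator σ G f ξ + dualGenerator σ G g ξ := by
  simp only [dualGenerator_eq, ← Finset.sum_add_distrib]
  exact Finset.sum_congr rfl fun i _ => by ring

/-- Minus the generator of the dual system killed at absorption. -/
def killedGenerator (σ : SignType) (G : Geometry N) (n : ℕ) :
    (activeStates σ G n → ℝ) →ₗ[ℝ] (activeStates σ G n → ℝ) where
  toFun g ξ := -dualGenerator σ G (extendZero g) ξ
  map_add' g g' := by
    ext ξ
    have : extendZero (g + g') = fun ξ => extendZero g ξ + extendZero g' ξ := by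
      ext ξ
      by_cases h : ξ ∈ activeStates σ G n <;> simp [extendZero, h]
    rw [this, dualGenerator_add]
    simp only [Pi.add_apply]
    ring
  map_smul' b g := by
    ext ξ
    have : extendZero (b • g) = fun ξ => b * extendZero g ξ := by
      ext ξ
      by_cases h : ξ ∈ activeStates σ G n <;> simp [extendZero, h]
    rw [this, dualGenerator_const_mul]
    simp

/-- The minimum principle with zero boundary values; it makes the inverse of `killedGenerator`
entrywise nonnegative. -/
lemma nonneg_of_killedGenerator_nonneg {n : ℕ} {g : activeStates σ G n → ℝ}
    (h : ∀ ξ, 0 ≤ killedGenerator σ G n g ξ) (ξ : activeStates σ G n) : 0 ≤ g ξ := by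
  rw [← extendZero_coe g ξ]
  refine nonneg_of_superharmonic (σ := σ) (G := G) (n := n) (fun ξ hξ h0 => ?_)
    (fun ξ _ h0 => (extendZero_of_absorbed g h0).ge) ξ (mem_activeStates.1 ξ.2).1
  exact neg_nonneg.1 (h ⟨ξ, mem_activeStates.2 ⟨hξ, h0⟩⟩)

lemma killedGenerator_injective (n : ℕ) : Function.Injective (killedGenerator σ G n) := by
  rw [← LinearMap.ker_eq_bot, LinearMap.ker_eq_bot']
  intro g hg
  ext ξ
  refine le_antisymm ?_ (nonneg_of_killedGenerator_nonneg (fun ξ => by rw [hg]; rfl) ξ)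
  exact neg_nonneg.1
    (nonneg_of_killedGenerator_nonneg (g := -g) (fun ξ => by rw [map_neg, hg]; simp) ξ)

/-- Occupation times: a positive solution of the adjoint equation of the killed dual system. -/
lemma exists_occupation (σ : SignType) (G : Geometry N) (n : ℕ) :
    ∃ w : (Fin N → ℕ) × ℕ × ℕ → ℝ, (∀ ξ ∈ activeStates σ G n, 0 < w ξ) ∧
      ∀ f : (Fin N → ℕ) × ℕ × ℕ → ℝ, (∀ ξ, ξ.1 = 0 → f ξ = 0) →
        ∑ ξ ∈ activeStates σ G n, w ξ * dualGenerator σ G f ξ =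
          -∑ ξ ∈ activeStates σ G n, f ξ := by
  classical
  let e := LinearEquiv.ofInjectiveEndo (killedGenerator σ G n) (killedGenerator_injective n)
  have he : ∀ g, e g = killedGenerator σ G n g := fun g => rfl
  -- A column sum of the Green matrix: the expected time spent in `ξ`, added up over all starting
  -- states.
  let v : activeStates σ G n → ℝ := fun ξ => ∑ ξ', e.symm (Pi.single ξ 1) ξ'
  have hnn : ∀ ξ ξ', 0 ≤ e.symm (Pi.single ξ 1) ξ' := by
    intro ξ
    refine nonneg_of_killedGenerator_nonneg fun ξ' => ?_
    rw [← he, e.apply_symm_apply]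
    rw [Pi.single_apply]
    split_ifs <;> norm_num
  have hv : ∀ ξ, 0 < v ξ := by
    intro ξ
    refine lt_of_le_of_ne (Finset.sum_nonneg fun ξ' _ => hnn ξ ξ') fun h => ?_
    have h0 := (Finset.sum_eq_zero_iff_of_nonneg fun ξ' _ => hnn ξ ξ').1 h.symm
    have h1 : e.symm (Pi.single ξ 1) = 0 := funext fun ξ' => h0 ξ' (Finset.mem_univ _)
    have h2 : (Pi.single ξ 1 : activeStates σ G n → ℝ) = 0 := e.symm.map_eq_zero_iff.1 h1
    have := congrFun h2 ξ
    simp at this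
  -- Column sums of an inverse matrix form a row vector which the matrix maps to the constant row
  -- `1`.
  have hdual : ∀ g : activeStates σ G n → ℝ, ∑ ξ, v ξ * e g ξ = ∑ ξ, g ξ := by
    intro g
    have h1 : g = ∑ ξ, e g ξ • e.symm (Pi.single ξ 1) := by
      apply e.injective
      simp only [map_sum, map_smul, e.apply_symm_apply]
      exact (pi_eq_sum_univ' (e g)).trans (by simp [Pi.single])
    conv_rhs => rw [h1]
    simp only [Finset.sum_apply, Pi.smul_apply, smul_eq_mul]
    rw [Finset.sum_comm]
    exact Finset.sum_congr rfl fun ξ _ => by rw [← Finset.mul_sum, mul_comm]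
  refine ⟨extendZero v, fun ξ hξ => ?_, fun f hf => ?_⟩
  · rw [extendZero_coe v ⟨ξ, hξ⟩]
    exact hv _
  · have h1 := hdual fun ξ => f ξ
    rw [← Finset.sum_coe_sort, ← Finset.sum_coe_sort (activeStates σ G n) f, ← h1, ← Finset.sum_neg_distrib]
    refine Finset.sum_congr rfl fun ξ _ => ?_
    rw [extendZero_coe, he]
    change _ = -(v ξ * -dualGenerator σ G (extendZero _) ξ)
    rw [mul_neg, neg_neg]
    congr 1
    refine dualGenerator_congr (n := n) (fun ξ hξ => ?_) (mem_activeStates.1 ξ.2).1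
    by_cases h0 : ξ.1 = 0
    · rw [hf ξ h0, extendZero_of_absorbed _ h0]
    · rw [extendZero, dif_pos (mem_activeStates.2 ⟨hξ, h0⟩)]

end Green

/-! ### The jumps of the boundary driven system -/

/-- The rates of the jumps due to a reservoir. -/
def reservoirRate (σ : SignType) (G : Geometry N) (w a θ : ℝ) (x : Fin N) :
    Bool → (Fin N → ℕ) → ℝ
  | true, η => w * (a * θ * ((G.α x : ℝ) + (σ : ℝ) * η x))
  | false, η => w * ((η x : ℝ) * (a + (σ : ℝ) * a * θ))

/-- The jumps due to a reservoir. -/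
def reservoirJump (x : Fin N) : Bool → (Fin N → ℕ) → Fin N → ℕ
  | true, η => addAt η x
  | false, η => removeAt η x

lemma reservoirGenerator_eq (w a θ : ℝ) (x : Fin N) (f : (Fin N → ℕ) → ℝ) (η : Fin N → ℕ) :
    w * reservoirGenerator σ G a θ x f η =
      ∑ b, reservoirRate σ G w a θ x b η * (f (reservoirJump x b η) - f η) := by
  rw [Fintype.sum_bool]
  simp only [reservoirGenerator, reservoirRate, reservoirJump]
  ring

lemma reservoirRate_nonneg {w a θ : ℝ} (hw : 0 ≤ w) (ha : 0 < a) (hθ : 0 ≤ θ)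
    (hσ : σ = -1 → θ ≤ 1) (x : Fin N) (b : Bool) {η : Fin N → ℕ}
    (hη : σ = -1 → ∀ x, η x ≤ G.α x) : 0 ≤ reservoirRate σ G w a θ x b η := by
  cases b
  · refine mul_nonneg hw (mul_nonneg (Nat.cast_nonneg _) ?_)
    rcases σ.trichotomy with rfl | rfl | rfl
    · have := hσ rfl
      simp only [SignType.coe_neg_one]
      nlinarith
    · simpa using ha.le
    · simp only [SignType.coe_one]
      positivity
  · exact mul_nonneg hw (mul_nonneg (mul_nonneg ha.le hθ) (rate_nonneg fun h => hη h x))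

lemma reservoirJump_valid {w a θ : ℝ} {x : Fin N} {b : Bool} {η : Fin N → ℕ}
    (hη : σ = -1 → ∀ x, η x ≤ G.α x) (h : reservoirRate σ G w a θ x b η ≠ 0) :
    σ = -1 → ∀ z, reservoirJump x b η z ≤ G.α z := by
  cases b
  · exact removeAt_valid x hη
  · exact addAt_valid hη (right_ne_zero_of_mul (right_ne_zero_of_mul h))

lemma reservoirJump_ne {w a θ : ℝ} {x : Fin N} {b : Bool} {η : Fin N → ℕ}
    (h : reservoirRate σ G w a θ x b η ≠ 0) : reservoirJump x b η ≠ η := by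
  intro e
  have e := congrFun e x
  cases b
  · have : (η x : ℝ) ≠ 0 := left_ne_zero_of_mul (right_ne_zero_of_mul h)
    rw [reservoirJump, removeAt_apply_self] at e
    have : η x ≠ 0 := by exact_mod_cast this
    omega
  · rw [reservoirJump, addAt_apply_self] at e
    omega

/-! ### Nonnegativity of the classical duality functions -/

/-- At an integer `n` the factors are nonnegative until `n - j` reaches zero, and the product is
zero from then on; hence the stronger inductive claim. -/
lemma dualPoly_nonneg {s a : ℝ} {k n : ℕ} (h : ∀ j < k, 0 ≤ a + s * (j : ℕ)) :
    0 ≤ dualPoly s a k n := by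
  have key : 0 ≤ dualPoly s a k n ∧ (n < k → dualPoly s a k n = 0) := by
    induction k with
    | zero => exact ⟨zero_le_one, fun h => absurd h (by omega)⟩
    | succ k ih =>
      obtain ⟨h1, h2⟩ := ih fun j hj => h j (by omega)
      simp only [dualPoly]
      rcases lt_trichotomy n k with hk | hk | hk
      · simp [h2 hk]
      · simp [hk]
      · have : (k : ℝ) ≤ n := by exact_mod_cast hk.le
        exact ⟨mul_nonneg (div_nonneg (by linarith) (h k (by omega))) h1,
          fun h => absurd h (by omega)⟩
  exact key.1

lemma bulkDual_zero_nonneg (η : Fin N → ℕ) {ξ : Fin N → ℕ} (hξ : σ = -1 → ∀ x, ξ x ≤ G.α x) :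
    0 ≤ bulkDual σ G 0 η ξ := by
  refine Finset.prod_nonneg fun x _ => ?_
  rw [siteDual_param_zero]
  exact dualPoly_nonneg fun j hj => rate_nonneg fun h => hj.le.trans (hξ h x)

lemma bulkDual_zero_right (θ : ℝ) (η : Fin N → ℕ) : bulkDual σ G θ η 0 = 1 :=
  Finset.prod_eq_one fun _ _ => rfl

/-- Multiplying by an occupation number stays in the span of duality functions, which reduces
polynomial moments to them. -/
lemma occ_mul_bulkDual_zero {η ξ : Fin N → ℕ} (x : Fin N) (hη : σ = -1 → ∀ x, η x ≤ G.α x)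
    (hξ : σ = -1 → ∀ x, ξ x ≤ G.α x) :
    η x * bulkDual σ G 0 η ξ = ξ x * bulkDual σ G 0 η ξ +
      ((G.α x : ℝ) + (σ : ℝ) * ξ x) * bulkDual σ G 0 η (addAt ξ x) := by
  obtain ⟨h1, h2, -⟩ := siteDual_relations 0 (G.α_pos x) (fun h => hξ h x) (fun h => hη h x)
  have e1 : bulkDual σ G 0 η ξ = siteDual σ (G.α x) 0 (ξ x) (η x) *
      ∏ z ∈ Finset.univ.erase x, siteDual σ (G.α z) 0 (ξ z) (η z) := by
    rw [bulkDual, ← Finset.mul_prod_erase _ _ (Finset.mem_univ x)]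
  have e2 : bulkDual σ G 0 η (addAt ξ x) = siteDual σ (G.α x) 0 (ξ x + 1) (η x) *
      ∏ z ∈ Finset.univ.erase x, siteDual σ (G.α z) 0 (ξ z) (η z) := by
    rw [bulkDual, ← Finset.mul_prod_erase _ _ (Finset.mem_univ x), addAt_apply_self]
    congr 1
    refine Finset.prod_congr rfl fun z hz => ?_
    rw [addAt_apply_of_ne (Finset.ne_of_mem_erase hz)]
  rw [e1, e2]
  linear_combination (∏ z ∈ Finset.univ.erase x, siteDual σ (G.α z) 0 (ξ z) (η z)) * (h1 + h2)

variable [NeZero N]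

/-- The rates of the jumps of the boundary driven system. -/
def configRate (σ : SignType) (G : Geometry N) (θL θR : ℝ) :
    (Fin N × Fin N) ⊕ (Bool ⊕ Bool) → (Fin N → ℕ) → ℝ
  | .inl i, η => bulkRate σ G i η
  | .inr (.inl b), η => reservoirRate σ G G.ωL G.αL θL (firstSite N) b η
  | .inr (.inr b), η => reservoirRate σ G G.ωR G.αR θR (lastSite N) b η

/-- The jumps of the boundary driven system. -/
def ambientJump : (Fin N × Fin N) ⊕ (Bool ⊕ Bool) → (Fin N → ℕ) → Fin N → ℕ
  | .inl i, η => moveTo η i.1 i.2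
  | .inr (.inl b), η => reservoirJump (firstSite N) b η
  | .inr (.inr b), η => reservoirJump (lastSite N) b η

lemma generator_eq (θL θR : ℝ) (f : (Fin N → ℕ) → ℝ) (η : Fin N → ℕ) :
    generator σ G θL θR f η =
      ∑ i, configRate σ G θL θR i η * (f (ambientJump i η) - f η) := by
  rw [Fintype.sum_sum_type, Fintype.sum_sum_type, generator, bulkGenerator_eq,
    reservoirGenerator_eq, reservoirGenerator_eq]
  rfl

lemma ambientJump_valid {θL θR : ℝ} {i : (Fin N × Fin N) ⊕ (Bool ⊕ Bool)} {η : Fin N → ℕ}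
    (hη : σ = -1 → ∀ x, η x ≤ G.α x) (h : configRate σ G θL θR i η ≠ 0) :
    σ = -1 → ∀ z, ambientJump i η z ≤ G.α z := by
  rcases i with i | b | b
  · exact moveTo_valid hη h
  · exact reservoirJump_valid hη h
  · exact reservoirJump_valid hη h

lemma ambientJump_ne {θL θR : ℝ} {i : (Fin N × Fin N) ⊕ (Bool ⊕ Bool)} {η : Fin N → ℕ}
    (h : configRate σ G θL θR i η ≠ 0) : ambientJump i η ≠ η := by
  rcases i with ⟨x, y⟩ | b | b
  · obtain ⟨h1, h2, -⟩ := bulkRate_ne_zero h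
    intro e
    have := congrFun e x
    simp only [ambientJump] at this
    rw [moveTo_apply_left h1] at this
    omega
  · exact reservoirJump_ne h
  · exact reservoirJump_ne h

open Classical in
/-- The jumps of the boundary driven system on its configuration space. -/
def configJump (i : (Fin N × Fin N) ⊕ (Bool ⊕ Bool)) (η : Config σ G) : Config σ G :=
  if h : σ = -1 → ∀ x, ambientJump i η.1 x ≤ G.α x then ⟨ambientJump i η.1, h⟩ else η

lemma coe_configJump {θL θR : ℝ} {i : (Fin N × Fin N) ⊕ (Bool ⊕ Bool)} {η : Config σ G}
    (h : configRate σ G θL θR i η.1 ≠ 0) : (configJump i η).1 = ambientJump i η.1 := by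
  rw [configJump, dif_pos (ambientJump_valid η.2 h)]

lemma rate_jumpRep {θL θR : ℝ} (hL : 0 ≤ θL) (hR : 0 ≤ θR) (hσ : σ = -1 → θL ≤ 1 ∧ θR ≤ 1) :
    JumpRep (rate σ G θL θR) (fun i η => configRate σ G θL θR i η.1) configJump where
  nonneg i η := by
    rcases i with i | b | b
    · exact bulkRate_nonneg i η.2
    · exact reservoirRate_nonneg G.ωL_nonneg G.αL_pos hL (fun h => (hσ h).1) _ _ η.2
    · exact reservoirRate_nonneg G.ωR_nonneg G.αR_pos hR (fun h => (hσ h).2) _ _ η.2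
  ne i η hi e := ambientJump_ne hi (by rw [← coe_configJump hi, e])
  rate η η' hne := by
    classical
    rw [rate, generator_eq]
    refine Finset.sum_congr rfl fun i _ => ?_
    have h1 : η.1 ≠ η'.1 := fun e => hne (Subtype.ext e)
    by_cases hi : configRate σ G θL θR i η.1 = 0
    · simp [hi]
    · rw [← coe_configJump hi]
      by_cases h2 : configJump i η = η'
      · simp [h1, h2]
      · have h3 : (configJump i η).1 ≠ η'.1 := fun e => h2 (Subtype.ext e)
        simp [h1, h2, h3]

lemma sum_configRate (θL θR : ℝ) (f : (Fin N → ℕ) → ℝ) (η : Config σ G) :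
    ∑ i, configRate σ G θL θR i η.1 * (f (configJump i η).1 - f η.1) =
      generator σ G θL θR f η.1 := by
  rw [generator_eq]
  refine Finset.sum_congr rfl fun i _ => ?_
  by_cases hi : configRate σ G θL θR i η.1 = 0
  · simp [hi]
  · rw [coe_configJump hi]

lemma generator_sum {κ : Type*} (F : Finset κ) (w : κ → ℝ) (θL θR : ℝ)
    (f : κ → (Fin N → ℕ) → ℝ) (η : Fin N → ℕ) :
    generator σ G θL θR (fun η => ∑ k ∈ F, w k * f k η) η =
      ∑ k ∈ F, w k * generator σ G θL θR (f k) η := by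
  simp only [generator_eq, Finset.mul_sum, ← Finset.sum_sub_distrib]
  rw [Finset.sum_comm]
  exact Finset.sum_congr rfl fun k _ => Finset.sum_congr rfl fun i _ => by ring

/-! ### Integrability of all moments under a stationary measure. -/

variable {μ : Measure (Config σ G)} [IsProbabilityMeasure μ] {θL θR : ℝ}

lemma integrable_lyapunov (hL : 0 ≤ θL) (hR : 0 ≤ θR) (hσ : σ = -1 → θL ≤ 1 ∧ θR ≤ 1)
    (hμ : IsStationary (rate σ G θL θR) μ) {V : (Fin N → ℕ) → ℝ} (hV : ∀ η, 0 ≤ V η) {κ C : ℝ}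
    (hκ : 0 < κ) (hgen : ∀ η : Config σ G, generator σ G θL θR V η.1 ≤ C - κ * V η.1) :
    Integrable (fun η : Config σ G => V η.1) μ := by
  have hint := (rate_jumpRep hL hR hσ).lintegral_lyapunov_le hμ (V := fun η => V η.1)
    -- `C` may be negative here; the general bound asks for a nonnegative constant, and `|C|`
    -- serves.
    (fun η => hV η.1) hκ (abs_nonneg C) fun η => by
      have h1 := hgen η
      rw [← sum_configRate] at h1
      simp only [mul_sub, Finset.sum_sub_distrib] at h1
      rw [← Finset.sum_mul] at h1
      rw [totalRate]
      linarith [le_abs_self C]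
  refine ⟨Measurable.of_discrete.aestronglyMeasurable, ?_⟩
  rw [hasFiniteIntegral_iff_ofReal (f := fun η : Config σ G => V η.1)
    (ae_of_all _ fun η => hV η.1)]
  exact hint.trans_lt ENNReal.ofReal_lt_top

/-- The Lyapunov function is the sum `V` of the duality functions with occupation weights `w`.
Duality and the adjoint equation for `w` give `ℒ V = C - ∑ D`, and `∑ D` controls `V` since the
weights are bounded. Positivity of `w ξ` then bounds each single duality function by a multiple of
`V`. -/
lemma integrable_dualFun_zero (hL : 0 ≤ θL) (hR : 0 ≤ θR) (hσ : σ = -1 → θL ≤ 1 ∧ θR ≤ 1)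
    (hμ : IsStationary (rate σ G θL θR) μ) {n : ℕ} {ξ : (Fin N → ℕ) × ℕ × ℕ}
    (hξ : ξ ∈ activeStates σ G n) :
    Integrable (fun η : Config σ G => dualFun σ G θL θR 0 η.1 ξ) μ := by
  obtain ⟨w, hw, hdual⟩ := exists_occupation σ G n
  have hD : ∀ (η : Fin N → ℕ), ∀ ξ ∈ activeStates σ G n, 0 ≤ dualFun σ G θL θR 0 η ξ := by
    intro η ξ hξ
    simp only [dualFun, sub_zero]
    exact mul_nonneg (mul_nonneg (pow_nonneg hL _) (pow_nonneg hR _))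
      (bulkDual_zero_nonneg η (mem_activeStates.1 hξ).1.1)
  classical
  set V : (Fin N → ℕ) → ℝ := fun η => ∑ ξ ∈ activeStates σ G n, w ξ * dualFun σ G θL θR 0 η ξ
  have hV : ∀ η, 0 ≤ V η := fun η =>
    Finset.sum_nonneg fun ξ hξ => mul_nonneg (hw ξ hξ).le (hD η ξ hξ)
  -- The values of the duality function at absorbed states, which do not depend on `η`. Subtracting
  -- them gives a function vanishing there, as `hdual` requires.
  set b : (Fin N → ℕ) × ℕ × ℕ → ℝ := fun ξ => if ξ.1 = 0 then θL ^ ξ.2.1 * θR ^ ξ.2.2 else 0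
  set C := ∑ ξ ∈ activeStates σ G n, w ξ * dualGenerator σ G b ξ
  set W := ∑ ξ ∈ activeStates σ G n, w ξ
  have hW : 0 ≤ W := Finset.sum_nonneg fun ξ hξ => (hw ξ hξ).le
  have hgen : ∀ η : Config σ G, generator σ G θL θR V η.1 =
      C - ∑ ξ ∈ activeStates σ G n, dualFun σ G θL θR 0 η.1 ξ := by
    intro η
    rw [generator_sum (f := fun ξ η => dualFun σ G θL θR 0 η ξ)]
    have h1 := hdual (fun ξ => dualFun σ G θL θR 0 η.1 ξ - b ξ) fun ξ h => by
      simp [b, h, dualFun, bulkDual_zero_right]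
    have h2 : ∑ ξ ∈ activeStates σ G n, (dualFun σ G θL θR 0 η.1 ξ - b ξ) =
        ∑ ξ ∈ activeStates σ G n, dualFun σ G θL θR 0 η.1 ξ :=
      Finset.sum_congr rfl fun ξ hξ => by simp [b, (mem_activeStates.1 hξ).2]
    rw [h2] at h1
    simp only [dualGenerator_sub, mul_sub, Finset.sum_sub_distrib] at h1
    rw [Finset.sum_congr rfl fun ξ hξ => by
      rw [generator_dualFun θL θR 0 η.2 (mem_activeStates.1 hξ).1.1]]
    linarith
  -- `W + 1` dominates every weight and is positive even for an empty sum.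
  have hκ : 0 < 1 / (W + 1) := by positivity
  have hVW : ∀ η, 1 / (W + 1) * V η ≤ ∑ ξ ∈ activeStates σ G n, dualFun σ G θL θR 0 η ξ := by
    intro η
    rw [Finset.mul_sum]
    refine Finset.sum_le_sum fun ξ hξ => ?_
    have h1 : w ξ ≤ W + 1 := (Finset.single_le_sum (fun ξ hξ => (hw ξ hξ).le) hξ).trans (by linarith)
    rw [← mul_assoc]
    refine mul_le_of_le_one_left (hD η ξ hξ) ?_
    rw [one_div, inv_mul_le_iff₀ (by positivity), mul_one]
    exact h1
  have hVint : Integrable (fun η : Config σ G => V η.1) μ :=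
    integrable_lyapunov hL hR hσ hμ hV hκ fun η => by
      rw [hgen η]
      exact sub_le_sub (le_refl C) (hVW η.1)
  refine (hVint.const_mul (w ξ)⁻¹).mono' Measurable.of_discrete.aestronglyMeasurable
    (ae_of_all _ fun η => ?_)
  rw [Real.norm_of_nonneg (hD η.1 ξ hξ), le_inv_mul_iff₀ (hw ξ hξ)]
  exact Finset.single_le_sum (f := fun ξ => w ξ * dualFun σ G θL θR 0 η.1 ξ)
    (fun ξ hξ => mul_nonneg (hw ξ hξ).le (hD η.1 ξ hξ)) hξ

lemma integrable_bulkDual_zero (hL : 0 ≤ θL) (hR : 0 ≤ θR) (hσ : σ = -1 → θL ≤ 1 ∧ θR ≤ 1)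
    (hμ : IsStationary (rate σ G θL θR) μ) {ξ : Fin N → ℕ} (hξ : σ = -1 → ∀ x, ξ x ≤ G.α x) :
    Integrable (fun η : Config σ G => bulkDual σ G 0 η.1 ξ) μ := by
  by_cases h0 : ξ = 0
  · subst h0
    simp [bulkDual_zero_right]
  · have := integrable_dualFun_zero hL hR hσ hμ (n := ∑ x, ξ x) (ξ := (ξ, 0, 0))
      (mem_activeStates.2 ⟨⟨hξ, by simp⟩, h0⟩)
    simpa [dualFun] using this

lemma integrable_total_pow_mul (hL : 0 ≤ θL) (hR : 0 ≤ θR) (hσ : σ = -1 → θL ≤ 1 ∧ θR ≤ 1)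
    (hμ : IsStationary (rate σ G θL θR) μ) (m : ℕ) {ξ : Fin N → ℕ}
    (hξ : σ = -1 → ∀ x, ξ x ≤ G.α x) :
    Integrable (fun η : Config σ G => (∑ x, (η.1 x : ℝ)) ^ m * bulkDual σ G 0 η.1 ξ) μ := by
  induction m generalizing ξ with
  | zero => simpa using integrable_bulkDual_zero hL hR hσ hμ hξ
  | succ m ih =>
    have e : ∀ η : Config σ G, (∑ x, (η.1 x : ℝ)) ^ (m + 1) * bulkDual σ G 0 η.1 ξ =
        ∑ x, (ξ x * ((∑ x, (η.1 x : ℝ)) ^ m * bulkDual σ G 0 η.1 ξ) +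
          ((G.α x : ℝ) + (σ : ℝ) * ξ x) *
            ((∑ x, (η.1 x : ℝ)) ^ m * bulkDual σ G 0 η.1 (addAt ξ x))) := by
      intro η
      rw [pow_succ, mul_assoc, Finset.sum_mul, Finset.mul_sum]
      refine Finset.sum_congr rfl fun x _ => ?_
      rw [occ_mul_bulkDual_zero x η.2 hξ]
      ring
    rw [funext e]
    refine integrable_finsetSum _ fun x _ => ((ih hξ).const_mul _).add ?_
    -- At a full exclusion site `addAt ξ x` is not admissible, but its coefficient vanishes.
    by_cases h0 : (G.α x : ℝ) + (σ : ℝ) * ξ x = 0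
    · simp [h0]
    · exact (ih (addAt_valid hξ h0)).const_mul _

lemma integrable_total_pow (hL : 0 ≤ θL) (hR : 0 ≤ θR) (hσ : σ = -1 → θL ≤ 1 ∧ θR ≤ 1)
    (hμ : IsStationary (rate σ G θL θR) μ) (m : ℕ) :
    Integrable (fun η : Config σ G => (1 + ∑ x, (η.1 x : ℝ)) ^ m) μ := by
  have h : ∀ k, Integrable (fun η : Config σ G => (∑ x, (η.1 x : ℝ)) ^ k) μ := fun k => by
    have := integrable_total_pow_mul hL hR hσ hμ k (ξ := 0) (fun _ _ => Nat.zero_le _)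
    simpa [bulkDual_zero_right] using this
  simp only [add_comm (1 : ℝ), add_pow, one_pow, mul_one]
  exact integrable_finsetSum _ fun k _ => (h k).mul_const _

end Moments

/-! ### Functions of polynomial growth -/

section PolyGrowth

variable {N : ℕ} {σ : SignType} {G : Geometry N}

/-- Polynomial growth in the number of particles. -/
def PolyGrowth (f : Config σ G → ℝ) : Prop :=
  ∃ (C : ℝ) (m : ℕ), ∀ η, |f η| ≤ C * (1 + ∑ x, (η.1 x : ℝ)) ^ m

lemma one_le_one_add_total (η : Config σ G) : 1 ≤ 1 + ∑ x, (η.1 x : ℝ) :=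
  le_add_of_nonneg_right (Finset.sum_nonneg fun _ _ => Nat.cast_nonneg _)

lemma PolyGrowth.const (b : ℝ) : PolyGrowth fun _ : Config σ G => b :=
  ⟨|b|, 0, fun η => by simp⟩

lemma PolyGrowth.occ (x : Fin N) : PolyGrowth fun η : Config σ G => (η.1 x : ℝ) := by
  refine ⟨1, 1, fun η => ?_⟩
  have := Finset.single_le_sum (f := fun x => (η.1 x : ℝ)) (fun _ _ => Nat.cast_nonneg _)
    (Finset.mem_univ x)
  rw [abs_of_nonneg (Nat.cast_nonneg _)]
  linarith

lemma PolyGrowth.add {f g : Config σ G → ℝ} (hf : PolyGrowth f) (hg : PolyGrowth g) :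
    PolyGrowth fun η => f η + g η := by
  obtain ⟨C, m, hC⟩ := hf
  obtain ⟨D, k, hD⟩ := hg
  refine ⟨|C| + |D|, max m k, fun η => (abs_add_le _ _).trans ?_⟩
  rw [add_mul]
  have h1 := one_le_one_add_total η
  refine add_le_add ((hC η).trans ?_) ((hD η).trans ?_)
  · exact mul_le_mul (le_abs_self C) (pow_le_pow_right₀ h1 (le_max_left _ _))
      (by positivity) (abs_nonneg C)
  · exact mul_le_mul (le_abs_self D) (pow_le_pow_right₀ h1 (le_max_right _ _))
      (by positivity) (abs_nonneg D)

lemma PolyGrowth.mul {f g : Config σ G → ℝ} (hf : PolyGrowth f) (hg : PolyGrowth g) :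
    PolyGrowth fun η => f η * g η := by
  obtain ⟨C, m, hC⟩ := hf
  obtain ⟨D, k, hD⟩ := hg
  refine ⟨C * D, m + k, fun η => ?_⟩
  rw [abs_mul, pow_add, mul_mul_mul_comm]
  exact mul_le_mul (hC η) (hD η) (abs_nonneg _) ((abs_nonneg _).trans (hC η))

lemma PolyGrowth.sum {κ : Type*} (F : Finset κ) {f : κ → Config σ G → ℝ}
    (hf : ∀ k, PolyGrowth (f k)) : PolyGrowth fun η => ∑ k ∈ F, f k η := by
  classical
  induction F using Finset.induction_on with
  | empty => simpa using PolyGrowth.const (σ := σ) (G := G) 0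
  | insert k F hk ih =>
    simp only [Finset.sum_insert hk]
    exact (hf k).add ih

lemma PolyGrowth.prod {κ : Type*} (F : Finset κ) {f : κ → Config σ G → ℝ}
    (hf : ∀ k, PolyGrowth (f k)) : PolyGrowth fun η => ∏ k ∈ F, f k η := by
  classical
  induction F using Finset.induction_on with
  | empty => simpa using PolyGrowth.const (σ := σ) (G := G) 1
  | insert k F hk ih =>
    simp only [Finset.prod_insert hk]
    exact (hf k).mul ih

lemma PolyGrowth.dualPoly (s a : ℝ) (x : Fin N) (k : ℕ) :
    PolyGrowth fun η : Config σ G => dualPoly s a k (η.1 x) := by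
  induction k with
  | zero => exact PolyGrowth.const 1
  | succ k ih =>
    have h := ((PolyGrowth.occ (σ := σ) (G := G) x).add (.const (-(k : ℝ)))).mul
      (.const (a + s * k)⁻¹)
    simpa only [BoundaryDriven.dualPoly, sub_eq_add_neg, div_eq_mul_inv] using h.mul ih

lemma PolyGrowth.binomTransform (r : ℝ) (k : ℕ) {f : ℕ → Config σ G → ℝ}
    (hf : ∀ j, PolyGrowth (f j)) :
    PolyGrowth fun η => binomTransform r k fun j => f j η := by
  induction k generalizing f with
  | zero => exact hf 0
  | succ k ih => exact (ih fun j => hf (j + 1)).add ((PolyGrowth.const r).mul (ih hf))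

lemma PolyGrowth.dualFun (θL θR θ : ℝ) (ξ : (Fin N → ℕ) × ℕ × ℕ) :
    PolyGrowth fun η : Config σ G => dualFun σ G θL θR θ η.1 ξ :=
  (PolyGrowth.const _).mul (.prod _ fun x => .binomTransform _ _ fun j => .dualPoly _ _ x j)

lemma PolyGrowth.scaledOccupation (x : Fin N) :
    PolyGrowth (scaledOccupation (σ := σ) (G := G) x) :=
  (PolyGrowth.occ x).mul (.const (G.α x : ℝ)⁻¹)

lemma PolyGrowth.centredOccupation (μ : Measure (Config σ G)) (x : Fin N) :
    PolyGrowth (centredOccupation μ x) := by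
  have h : BoundaryDriven.centredOccupation μ x =
      fun η => BoundaryDriven.scaledOccupation x η +
        -∫ η', BoundaryDriven.scaledOccupation x η' ∂μ := by
    ext η; rw [← sub_eq_add_neg]; rfl
  rw [h]
  exact (PolyGrowth.scaledOccupation x).add (.const _)

variable [NeZero N]

lemma sum_configJump_le (i : (Fin N × Fin N) ⊕ (Bool ⊕ Bool)) (η : Config σ G) :
    ∑ x, ((configJump i η).1 x : ℝ) ≤ 1 + ∑ x, (η.1 x : ℝ) := by
  have h1 : ∀ (η : Fin N → ℕ) x, ∑ z, removeAt η x z ≤ ∑ z, η z := fun η x =>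
    Finset.sum_le_sum fun z _ => removeAt_le η x z
  have h2 : ∑ x, (configJump i η).1 x ≤ 1 + ∑ x, η.1 x := by
    rw [configJump]
    split_ifs
    · rcases i with ⟨x, y⟩ | b | b
      · have := h1 η.1 x
        simp only [ambientJump, moveTo, sum_addAt]
        omega
      all_goals
        cases b
        · exact (h1 _ _).trans (by omega)
        · simp only [ambientJump, reservoirJump, sum_addAt]
          omega
    · omega
  exact_mod_cast h2

lemma PolyGrowth.comp_configJump {f : Config σ G → ℝ} (hf : PolyGrowth f)
    (i : (Fin N × Fin N) ⊕ (Bool ⊕ Bool)) : PolyGrowth fun η => f (configJump i η) := by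
  obtain ⟨C, m, hC⟩ := hf
  -- A jump adds at most one particle, so `1 + |η|` at most doubles.
  refine ⟨|C| * 2 ^ m, m, fun η => (hC _).trans ?_⟩
  have h1 := one_le_one_add_total η
  have h2 := one_le_one_add_total (configJump i η)
  have h3 := sum_configJump_le i η
  rw [mul_assoc, ← mul_pow]
  exact mul_le_mul (le_abs_self C) (pow_le_pow_left₀ (by linarith) (by linarith) m)
    (by positivity) (abs_nonneg C)

lemma PolyGrowth.configRate (θL θR : ℝ) (i : (Fin N × Fin N) ⊕ (Bool ⊕ Bool)) :
    PolyGrowth fun η : Config σ G => configRate σ G θL θR i η.1 := by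
  have h : ∀ x, PolyGrowth fun η : Config σ G => (G.α x : ℝ) + (σ : ℝ) * η.1 x := fun x =>
    (PolyGrowth.const _).add ((PolyGrowth.const _).mul (.occ x))
  rcases i with ⟨x, y⟩ | b | b
  · exact (PolyGrowth.const _).mul ((PolyGrowth.occ x).mul (h y))
  all_goals
    cases b
    · exact (PolyGrowth.const _).mul ((PolyGrowth.occ _).mul (.const _))
    · exact (PolyGrowth.const _).mul ((PolyGrowth.const _).mul (h _))

/-! ### Stationary expectations of the duality functions. -/

variable {μ : Measure (Config σ G)} [IsProbabilityMeasure μ] {θL θR : ℝ}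

lemma PolyGrowth.integrable (hL : 0 ≤ θL) (hR : 0 ≤ θR) (hσ : σ = -1 → θL ≤ 1 ∧ θR ≤ 1)
    (hμ : IsStationary (rate σ G θL θR) μ) {f : Config σ G → ℝ} (hf : PolyGrowth f) :
    Integrable f μ := by
  obtain ⟨C, m, hC⟩ := hf
  exact ((integrable_total_pow hL hR hσ hμ m).const_mul C).mono'
    Measurable.of_discrete.aestronglyMeasurable (ae_of_all _ hC)

/-- The expected duality functions are harmonic for the dual system. -/
lemma dualGenerator_integral_dualFun (hL : 0 ≤ θL) (hR : 0 ≤ θR)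
    (hσ : σ = -1 → θL ≤ 1 ∧ θR ≤ 1) (hμ : IsStationary (rate σ G θL θR) μ) (θ : ℝ)
    {ξ : (Fin N → ℕ) × ℕ × ℕ} (hξ : σ = -1 → ∀ x, ξ.1 x ≤ G.α x) :
    dualGenerator σ G (fun ξ => ∫ η, dualFun σ G θL θR θ η.1 ξ ∂μ) ξ = 0 := by
  have hI : ∀ {f : Config σ G → ℝ}, PolyGrowth f → Integrable f μ :=
    fun hf => hf.integrable hL hR hσ hμ
  have hD := fun ξ => PolyGrowth.dualFun (σ := σ) (G := G) θL θR θ ξ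
  have hc := PolyGrowth.configRate (σ := σ) (G := G) θL θR
  have h0 := (rate_jumpRep hL hR hσ).integral_generator_eq_zero hμ
    (f := fun η => dualFun σ G θL θR θ η.1 ξ)
    (hI (.sum _ hc)) (hI ((PolyGrowth.sum _ hc).mul (hD ξ)))
    (fun i => hI ((hc i).mul ((hD ξ).comp_configJump i)))
  rw [← h0, dualGenerator_eq]
  -- Duality replaces the generator in `η` by a finite sum in `ξ` with coefficients independent of
  -- `η`, which can be taken out of the integral.
  have e : ∀ η : Config σ G, ∑ i, configRate σ G θL θR i η.1 *
      (dualFun σ G θL θR θ (configJump i η).1 ξ - dualFun σ G θL θR θ η.1 ξ) =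
      ∑ i, dualJumpRate σ G i ξ *
        (dualFun σ G θL θR θ η.1 (dualJump i ξ) - dualFun σ G θL θR θ η.1 ξ) := by
    intro η
    rw [sum_configRate θL θR (fun η => dualFun σ G θL θR θ η ξ), generator_dualFun _ _ _ η.2 hξ,
      dualGenerator_eq]
  rw [integral_congr_ae (ae_of_all _ e), integral_finsetSum]
  · refine Finset.sum_congr rfl fun i _ => ?_
    rw [integral_const_mul, integral_sub (hI (hD _)) (hI (hD _))]
  · exact fun i _ => ((hI (hD _)).sub (hI (hD _))).const_mul _

/-- Expectations of the duality functions in terms of the absorption probabilities. -/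
lemma integral_dualFun (hL : 0 ≤ θL) (hR : 0 ≤ θR) (hσ : σ = -1 → θL ≤ 1 ∧ θR ≤ 1)
    (hμ : IsStationary (rate σ G θL θR) μ) {n : ℕ} {ξ : (Fin N → ℕ) × ℕ × ℕ}
    (hξ : ξ ∈ dualStates σ G n) :
    ∫ η, dualFun σ G θL θR θR η.1 ξ ∂μ = (θL - θR) ^ n * absorption σ G ξ := by
  refine eq_of_harmonic (σ := σ) (G := G) (g := fun ξ => (θL - θR) ^ n * absorption σ G ξ)
    (fun ξ hξ _ => dualGenerator_integral_dualFun hL hR hσ hμ θR hξ.1)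
    (fun ξ hξ h0 => ?_) (fun ξ hξ h0 => ?_) ξ hξ
  · rw [dualGenerator_const_mul, dualGenerator_absorption hξ h0, mul_zero]
  · have hn := hξ.2
    simp only [h0, Pi.zero_apply, Finset.sum_const_zero, add_zero] at hn
    rw [absorption_of_absorbed h0, ← hn]
    simp only [dualFun, h0, bulkDual_zero_right, sub_self, mul_one, integral_const,
      probReal_univ, one_smul]
    -- At absorbed states both sides carry `0 ^ ξ(R)`: on the left it is `(θR - θR) ^ ξ(R)`, on the
    -- right the absorption probability.
    rcases Nat.eq_zero_or_pos ξ.2.2 with h | h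
    · simp [h]
    · simp [h.ne']

end PolyGrowth

/-! ### Independent walkers -/

section Independent

variable {N : ℕ} {σ : SignType} {G : Geometry N}

lemma removeAt_single (x : Fin N) : removeAt (Pi.single x 1) x = 0 := by simp [removeAt]

lemma moveTo_single (x y : Fin N) : moveTo (Pi.single x 1) x y = Pi.single y 1 := by
  simp [moveTo, removeAt_single, addAt]

lemma single_le_α (x : Fin N) : ∀ z, (Pi.single x 1 : Fin N → ℕ) z ≤ G.α z := by
  intro z
  have := G.α_pos z
  by_cases h : z = x
  · subst h; rwa [Pi.single_eq_same]
  · simp [h]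

lemma single_mem (x : Fin N) : ((Pi.single x 1, 0, 0) : (Fin N → ℕ) × ℕ × ℕ) ∈
    dualStates σ G 1 := ⟨fun _ => single_le_α x, by simp⟩

lemma toProd_deltaSum (A : Finset (Fin N)) :
    (deltaSum σ G A).toProd = (fun x => if x ∈ A then 1 else 0, 0, 0) := rfl

lemma size_deltaSum (A : Finset (Fin N)) : size (deltaSum σ G A) = A.card := by
  simp [size, deltaSum]

variable [NeZero N]

/-- The probability that a single particle started from `x` is absorbed in `L`. -/
def oneParticle (G : Geometry N) (x : Fin N) : ℝ := absorption 0 G (Pi.single x 1, 0, 0)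

/-- The drift of the absorption probability of a particle at `x`. -/
def oneParticleDrift (G : Geometry N) (x : Fin N) : ℝ :=
  ∑ y, G.ω x y * G.α y * (oneParticle G y - oneParticle G x) +
    ((if x = firstSite N then G.ωL * G.αL * (1 - oneParticle G x) else 0) +
      if x = lastSite N then G.ωR * G.αR * (0 - oneParticle G x) else 0)

/-- Harmonicity of the absorption probability at a one-particle configuration, where only the
occupied site contributes to the generator. -/
lemma oneParticleDrift_eq_zero (x : Fin N) : oneParticleDrift G x = 0 := by
  refine Eq.trans ?_ (dualGenerator_absorption (single_mem (σ := 0) (G := G) x) (by simp))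
  rw [dualGenerator, bulkGenerator, oneParticleDrift]
  congr 1
  · refine ((Finset.sum_eq_single x (fun z _ hz => ?_) (by simp)).trans ?_).symm
    · simp [hz]
    · refine Finset.sum_congr rfl fun y _ => ?_
      rw [moveTo_single]
      simp [oneParticle, mul_assoc]
  · congr 1
    · by_cases hx : x = firstSite N
      · rw [if_pos hx, ← hx]
        dsimp only
        rw [removeAt_single, absorption_of_absorbed (σ := 0) (G := G) (ξ := (0, 0 + 1, 0)) rfl]
        simp [oneParticle]
      · simp [hx, Ne.symm hx]
    · by_cases hx : x = lastSite N
      · rw [if_pos hx, ← hx]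
        dsimp only
        rw [removeAt_single, absorption_of_absorbed (σ := 0) (G := G) (ξ := (0, 0, 0 + 1)) rfl]
        simp [oneParticle]
      · simp [hx, Ne.symm hx]

/-- The weights `u` are free, so that many-particle generators can be recognised as weighted sums of
one-particle drifts. -/
lemma sum_mul_oneParticleDrift (u : Fin N → ℝ) :
    ∑ x, ∑ y, G.ω x y * (u x * G.α y * (oneParticle G y - oneParticle G x)) +
      (G.ωL * G.αL * (u (firstSite N) * (1 - oneParticle G (firstSite N))) +
        G.ωR * G.αR * (u (lastSite N) * (0 - oneParticle G (lastSite N)))) = 0 := by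
  refine Eq.trans ?_ (show ∑ x, u x * oneParticleDrift G x = 0 from
    Finset.sum_eq_zero fun x _ => by rw [oneParticleDrift_eq_zero, mul_zero])
  simp only [oneParticleDrift, mul_add, Finset.sum_add_distrib, Finset.mul_sum, mul_ite, mul_zero,
    Finset.sum_ite_eq', Finset.mem_univ, if_true]
  congr 1
  · exact Finset.sum_congr rfl fun x _ => Finset.sum_congr rfl fun y _ => by ring
  · ring

/-- A single particle does not feel the interaction. -/
lemma absorption_single (σ : SignType) (x : Fin N) :
    absorption σ G (Pi.single x 1, 0, 0) = oneParticle G x := by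
  set p := oneParticle G
  -- The comparison function is the expected number of particles in `L` at the end if each particle
  -- is absorbed there with probability `p`.
  have key := eq_of_harmonic (σ := σ) (G := G) (n := 1) (f := absorption σ G)
    (g := fun ξ => ∑ z, ξ.1 z * p z + ξ.2.1)
    (fun ξ hξ h0 => dualGenerator_absorption hξ h0) (fun ξ _ _ => ?_) (fun ξ hξ h0 => ?_)
    _ (single_mem x)
  · rw [key]
    simp [Pi.single_apply]
  · have hadd : ∀ (η : Fin N → ℕ) y,
        ∑ z, (addAt η y z : ℝ) * p z = ∑ z, (η z : ℝ) * p z + p y := by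
      intro η y
      simp [addAt, add_mul, Finset.sum_add_distrib, Pi.single_apply]
    have hrem : ∀ (η : Fin N → ℕ) y, η y ≠ 0 →
        ∑ z, (removeAt η y z : ℝ) * p z = ∑ z, (η z : ℝ) * p z - p y := by
      intro η y hy
      have := hadd (removeAt η y) y
      rw [addAt_removeAt hy] at this
      linarith
    have hocc : ∀ y (b c : ℝ), (ξ.1 y ≠ 0 → b = c) → (ξ.1 y : ℝ) * b = ξ.1 y * c := by
      intro y b c h
      by_cases hy : ξ.1 y = 0
      · simp [hy]
      · rw [h hy]
    refine Eq.trans ?_ (sum_mul_oneParticleDrift (G := G) fun x => (ξ.1 x : ℝ))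
    rw [dualGenerator, bulkGenerator]
    congr 1
    · have e1 : ∀ y z, G.ω y z * ((ξ.1 y : ℝ) * ((G.α z : ℝ) + (σ : ℝ) * ξ.1 z) *
          ((∑ w, (moveTo ξ.1 y z w : ℝ) * p w + ξ.2.1) - (∑ w, (ξ.1 w : ℝ) * p w + ξ.2.1))) =
          G.ω y z * ((ξ.1 y : ℝ) * ((G.α z : ℝ) + (σ : ℝ) * ξ.1 z) * (p z - p y)) := by
        intro y z
        congr 1
        rw [mul_assoc, mul_assoc]
        refine hocc _ _ _ fun hy => ?_
        rw [moveTo, hadd, hrem _ _ hy]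
        ring
      rw [Finset.sum_congr rfl fun y _ => Finset.sum_congr rfl fun z _ => e1 y z]
      -- The interaction term is symmetric in `y, z` while `p z - p y` is antisymmetric, so `σ`
      -- cancels along each edge.
      refine sum_eq_of_symm fun y z => ?_
      rw [G.ω_symm z y]
      ring
    · congr 1 <;> rw [mul_assoc] <;> congr 1 <;> refine hocc _ _ _ fun hy => ?_ <;>
        dsimp only <;> rw [hrem _ _ hy] <;> push_cast <;> ring
  · rw [absorption_of_absorbed h0]
    have hn := hξ.2
    simp only [h0, Pi.zero_apply, Finset.sum_const_zero, add_zero] at hn ⊢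
    obtain ⟨ξ, l, r⟩ := ξ
    dsimp only at hn ⊢
    obtain ⟨rfl, rfl⟩ | ⟨rfl, rfl⟩ : (l = 1 ∧ r = 0) ∨ (l = 0 ∧ r = 1) := by omega
    · simp
    · simp

/-- Independent walkers are absorbed independently. -/
lemma absorption_independent {n : ℕ} {ξ : (Fin N → ℕ) × ℕ × ℕ} (hξ : ξ ∈ dualStates 0 G n) :
    absorption 0 G ξ = 0 ^ ξ.2.2 * ∏ x, oneParticle G x ^ ξ.1 x := by
  set p := oneParticle G
  refine eq_of_harmonic (σ := 0) (G := G) (n := n) (f := absorption 0 G)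
    (g := fun ξ => 0 ^ ξ.2.2 * ∏ x, p x ^ ξ.1 x)
    (fun ξ hξ h0 => dualGenerator_absorption hξ h0) (fun ξ _ _ => ?_) (fun ξ hξ h0 => ?_) _ hξ
  · have hadd : ∀ (η : Fin N → ℕ) y, ∏ z, p z ^ addAt η y z = (∏ z, p z ^ η z) * p y := by
      intro η y
      simp only [addAt, Pi.add_apply, pow_add, Finset.prod_mul_distrib]
      congr 1
      rw [Finset.prod_eq_single y] <;> simp +contextual
    have hrem : ∀ y, ξ.1 y ≠ 0 → ∏ z, p z ^ ξ.1 z = (∏ z, p z ^ removeAt ξ.1 y z) * p y := by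
      intro y hy
      rw [← hadd, addAt_removeAt hy]
    have hocc : ∀ y (b c : ℝ), (ξ.1 y ≠ 0 → b = c) → (ξ.1 y : ℝ) * b = ξ.1 y * c := by
      intro y b c h
      by_cases hy : ξ.1 y = 0
      · simp [hy]
      · rw [h hy]
    -- Moving one particle from `x` changes one factor `p x` of the product; the weight is what the
    -- other particles contribute.
    refine Eq.trans ?_ (sum_mul_oneParticleDrift (G := G)
      fun x => (ξ.1 x : ℝ) * (0 ^ ξ.2.2 * ∏ z, p z ^ removeAt ξ.1 x z))
    rw [dualGenerator, bulkGenerator]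
    congr 1
    · refine Finset.sum_congr rfl fun y _ => Finset.sum_congr rfl fun z _ => ?_
      congr 1
      simp only [mul_assoc]
      refine hocc _ _ _ fun hy => ?_
      rw [moveTo, hadd, hrem y hy]
      simp
      ring
    · congr 1 <;> rw [mul_assoc, mul_assoc (ξ.1 _ : ℝ)] <;> congr 1 <;>
        refine hocc _ _ _ fun hy => ?_ <;>
        dsimp only <;> rw [hrem _ hy] <;> ring
  · rw [absorption_of_absorbed h0]
    simp [h0]

lemma absorbedLeft_deltaSum_independent (A : Finset (Fin N)) :
    (absorbedLeft 0 G (deltaSum 0 G A)).toReal = ∏ x ∈ A, oneParticle G x := by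
  rw [← absorption_toProd, absorption_independent (deltaSum 0 G A).toProd_mem, toProd_deltaSum]
  simp [Finset.prod_ite_mem, pow_ite]

lemma correlationCoeff_eq (A : Finset (Fin N)) :
    correlationCoeff σ G A = ∑ B ∈ A.powerset, (-1) ^ (A.card - B.card) *
      (∏ x ∈ A \ B, oneParticle G x) * (absorbedLeft σ G (deltaSum σ G B)).toReal := by
  simp only [correlationCoeff, absorbedLeft_deltaSum_independent]

end Independent

/-! ### Correlations and cumulants -/

section Correlations

variable {N : ℕ} [NeZero N] {σ : SignType} {G : Geometry N}
  {μ : Measure (Config σ G)} [IsProbabilityMeasure μ] {θL θR : ℝ}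

/-- With at most one dual particle per site, each site polynomial is `1` or `η x / α x - θR`. -/
lemma integral_prod_scaledOccupation (hL : 0 ≤ θL) (hR : 0 ≤ θR)
    (hσ : σ = -1 → θL ≤ 1 ∧ θR ≤ 1) (hμ : IsStationary (rate σ G θL θR) μ)
    (A : Finset (Fin N)) :
    ∫ η, ∏ x ∈ A, (scaledOccupation x η - θR) ∂μ =
      (θL - θR) ^ A.card * (absorbedLeft σ G (deltaSum σ G A)).toReal := by
  have h := integral_dualFun hL hR hσ hμ (deltaSum σ G A).toProd_mem
  rw [absorption_toProd, size_deltaSum] at h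
  rw [← h]
  refine integral_congr_ae (ae_of_all _ fun η => ?_)
  simp only [toProd_deltaSum, dualFun, bulkDual, pow_zero, one_mul]
  rw [← Finset.prod_subset (Finset.subset_univ A) fun x _ hx => by rw [if_neg hx, siteDual_zero]]
  refine Finset.prod_congr rfl fun x hx => ?_
  rw [if_pos hx, siteDual_one]
  rfl

lemma integral_scaledOccupation (hL : 0 ≤ θL) (hR : 0 ≤ θR)
    (hσ : σ = -1 → θL ≤ 1 ∧ θR ≤ 1) (hμ : IsStationary (rate σ G θL θR) μ) (x : Fin N) :
    ∫ η, scaledOccupation x η ∂μ = θR + (θL - θR) * oneParticle G x := by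
  have h := integral_prod_scaledOccupation hL hR hσ hμ {x}
  have e : (deltaSum σ G {x}).toProd = (Pi.single x 1, 0, 0) := by
    rw [toProd_deltaSum]
    simp only [Prod.mk.injEq, and_true]
    ext z
    simp [Pi.single_apply]
  rw [← absorption_toProd, e, absorption_single] at h
  simp only [Finset.prod_singleton, Finset.card_singleton, pow_one] at h
  rw [integral_sub ((PolyGrowth.scaledOccupation x).integrable hL hR hσ hμ)
    (integrable_const _)] at h
  simp only [integral_const, probReal_univ, one_smul] at h
  linarith

/-- The centred correlations of a stationary measure. -/
lemma integral_prod_centredOccupation (hL : 0 ≤ θL) (hR : 0 ≤ θR)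
    (hσ : σ = -1 → θL ≤ 1 ∧ θR ≤ 1) (hμ : IsStationary (rate σ G θL θR) μ)
    (A : Finset (Fin N)) :
    ∫ η, ∏ x ∈ A, centredOccupation μ x η ∂μ =
      (θL - θR) ^ A.card * correlationCoeff σ G A := by
  have e : ∀ η : Config σ G, ∏ x ∈ A, centredOccupation μ x η =
      ∑ B ∈ A.powerset, (∏ x ∈ A \ B, -((θL - θR) * oneParticle G x)) *
        ∏ x ∈ B, (scaledOccupation x η - θR) := by
    intro η
    have : ∀ x, centredOccupation μ x η =
        (scaledOccupation x η - θR) + -((θL - θR) * oneParticle G x) := by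
      intro x
      rw [centredOccupation, integral_scaledOccupation hL hR hσ hμ]
      ring
    simp only [this]
    -- Each centred variable is its deviation from `θR` minus `(θL - θR) p_x`; the expansion runs
    -- over the set `B` of sites where the former is chosen.
    rw [Finset.prod_add]
    exact Finset.sum_congr rfl fun B _ => mul_comm _ _
  rw [integral_congr_ae (ae_of_all _ e), integral_finsetSum, correlationCoeff_eq, Finset.mul_sum]
  · refine Finset.sum_congr rfl fun B hB => ?_
    have hBA := Finset.mem_powerset.1 hB
    have hcard := Finset.card_sdiff_add_card_eq_card hBA
    rw [integral_const_mul, integral_prod_scaledOccupation hL hR hσ hμ, Finset.prod_neg,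
      Finset.prod_mul_distrib, Finset.prod_const, ← hcard, Nat.add_sub_cancel, pow_add]
    ring
  · intro B _
    refine Integrable.const_mul ?_ _
    refine PolyGrowth.integrable hL hR hσ hμ (.prod _ fun x => ?_)
    simpa [sub_eq_add_neg] using (PolyGrowth.scaledOccupation x).add (.const (-θR))

/-- Homogeneity: for each partition the powers of `θL - θR` multiply to the exponent `|A|`. -/
lemma jointCumulant_eq (hL : 0 ≤ θL) (hR : 0 ≤ θR)
    (hσ : σ = -1 → θL ≤ 1 ∧ θR ≤ 1) (hμ : IsStationary (rate σ G θL θR) μ)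
    (A : Finset (Fin N)) :
    jointCumulant μ A (centredOccupation μ) = (θL - θR) ^ A.card * cumulantCoeff σ G A := by
  rw [jointCumulant, cumulantCoeff, Finset.mul_sum]
  refine Finset.sum_congr rfl fun γ _ => ?_
  rw [Finset.prod_congr rfl fun U _ => integral_prod_centredOccupation hL hR hσ hμ U,
    Finset.prod_mul_distrib, Finset.prod_pow_eq_pow_sum, γ.sum_card_parts]
  ring

end Correlations

end BoundaryDriven

end

open BoundaryDriven
theorem mainTheorem9 {N : ℕ} [NeZero N] (σ : SignType) (G : Geometry N) (θL θR : ℝ)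
    (hL : 0 ≤ θL) (hR : 0 ≤ θR) (hσ : σ = -1 → θL ≤ 1 ∧ θR ≤ 1)
    (μ : Measure (Config σ G)) [IsProbabilityMeasure μ]
    (hμ : IsStationary (rate σ G θL θR) μ)
    (n : ℕ) (hn : 1 ≤ n) (x : Fin n ↪ Fin N) :
    (∀ (τ : SignType) (ξ : DualConfig τ G),
      Tendsto (fun t : ℝ => transition (dualRate τ G) t ξ (allLeft τ G (size ξ))) atTop
        (𝓝 (absorbedLeft τ G ξ))) ∧
    (∀ y : Fin N, Integrable (scaledOccupation (σ := σ) (G := G) y) μ) ∧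
    (∀ U : Finset (Fin N), Integrable (fun η => ∏ y ∈ U, centredOccupation μ y η) μ) ∧
    jointCumulant μ (Finset.univ.map x) (centredOccupation μ) =
      (θL - θR) ^ n * cumulantCoeff σ G (Finset.univ.map x) := by
  refine ⟨fun τ ξ => tendsto_absorbedLeft ξ,
    fun y => (PolyGrowth.scaledOccupation y).integrable hL hR hσ hμ,
    fun U => (PolyGrowth.prod U (PolyGrowth.centredOccupation μ)).integrable hL hR hσ hμ, ?_⟩
  rw [jointCumulant_eq hL hR hσ hμ, Finset.card_map, Finset.card_univ, Fintype.card_fin]
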